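/- Let $\mathcal X\subset\mathbb R^{n_x}$, $\mathcal Y\subset\mathbb R^{n_y}$ be compact convex sets and $\mathcal L:\mathbb R^{n_x}\times\mathbb R^{n_y}\to\mathbb R$ be continuously differentiable on an open set containing $\mathcal X\times\mathcal Y$. Let $\mu\ge 0$ be such that $\mathcal L(x,\cdot)$ is $\mu$-strongly concave on $\mathcal Y$ for every $x\in\mathcal X$ (for $\mu=0$: concave), and let $L_{xx},L_{yy}\ge 0$, $L_{yx}>0$ be such that for all $(x,y),(x',y')\in\mathcal X\times\mathcal Y$ $$\|\nabla_x\mathcal L(x,y)-\nabla_x\mathcal L(x',y')\|\le L_{xx}\|x-x'\|+L_{yx}\|y-y'\|,\qquad \|\nabla_y\mathcal L(x,y)-\nabla_y\mathcal L(x',y')\|\le L_{yx}\|x-x'\|+L_{yy}\|y-y'\|.$$ Norms are Euclidean. No convexity in $x$ is assumed. Put $$G_{\mathcal X}(x,y)=\max_{v\in\mathcal X}\nabla_x\mathcal L(x,y)^\top(x-v),\qquad G_{\mathcal Y}(x,y)=\max_{u\in\mathcal Y}\mathcal L(x,u)-\mathcal L(x,y).$$ Given stepsizes $\tau_t\in[0,1]$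 and smoothing parameters $\beta_t\ge 0$, the LMO-LMO algorithm starts from any $x_0\in\mathcal X$, $y_0\in\mathcal Y$, and with $\mathcal L_{\beta}(x,y)=\mathcal L(x,y)-\frac{\beta}{2}\|y-y_0\|^2$ iterates, for $t=0,1,2,\dots$, $$v_t\in\operatorname*{argmin}_{v\in\mathcal X}\nabla_x\mathcal L(x_t,y_t)^\top v,\qquad x_{t+1}=x_t+\tau_t(v_t-x_t),$$ $$u_t\in\operatorname*{argmin}_{u\in\mathcal Y}-\nabla_y\mathcal L_{\beta_t}(x_t,y_t)^\top u,\qquad y_{t+1}=y_t+\gamma_t(u_t-y_t),\qquad \gamma_t=\min\Big\{\frac{\nabla_y\mathcal L_{\beta_t}(x_t,y_t)^\top(u_t-y_t)}{(L_{yy}+\beta_t)\|u_t-y_t\|^2},1\Big\}$$ (with $y_{t+1}=y_t$ if $u_t=y_t$). We say that $\mathcal Y$ is $\alpha$-strongly convex if $\xi y+(1-\xi)y'+\xi(1-\xi)\frac{\alpha}{2}\|y-y'\|^2z\in\mathcal Y$ for all $y,y'\in\mathcal Y$, $\xi\in[0,1]$ and all $z\in\mathbb R^{n_y}$ with $\|z\|=1$.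 Then, in each of the following four cases, there is a constant $K$, independent of $T$, of the initial point and of the choices made by the oracles, such that for every $T\ge 0$ $$\frac1{T+1}\sum_{t=0}^{T}G_{\mathcal X}(x_t,y_t)\le K\,(T+1)^{-r},\qquad G_{\mathcal Y}(x_T,y_T)\le K\,(T+1)^{-r}.$$ (i) (NC-C) $\tau_t=\Theta(t^{-5/6})$, $\beta_t>0$ is nonincreasing with $\beta_t=\Theta(t^{-1/6})$, and $r=\frac16$. (ii) (NC-SC) $\mu>0$, $\tau_t=\Theta(t^{-3/4})$, $\beta_t=0$ for all $t$, and $r=\frac14$. (iii) (NC-C, strongly convex $\mathcal Y$) $\mathcal Y$ is $\alpha$-strongly convex for some $\alpha>0$, $\tau_t=\Theta(t^{-4/5})$, $\beta_t>0$ is nonincreasing with $\beta_t=\Theta(t^{-1/5})$, and $r=\frac15$. (iv) (NC-SC, strongly convex $\mathcal Y$) $\mu>0$, $\mathcal Y$ is $\alpha$-strongly convex for some $\alpha>0$, $\tau_t=\Theta(t^{-2/3})$, $\beta_t=0$ for all $t$, and $r=\frac13$. -/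

import Mathlib

namespace MinimaxLMO

noncomputable section

/-- `ℝⁿ` with its Euclidean norm and inner product. -/
abbrev Vec (n : ℕ) : Type := EuclideanSpace ℝ (Fin n)

variable {nx ny : ℕ}

/-- The partial gradient `∇ₓ L(x, y)`. -/
def gradX (L : Vec nx → Vec ny → ℝ) (x : Vec nx) (y : Vec ny) : Vec nx :=
  gradient (fun x' => L x' y) x

/-- The partial gradient `∇_y L(x, y)`. -/
def gradY (L : Vec nx → Vec ny → ℝ) (x : Vec nx) (y : Vec ny) : Vec ny :=
  gradient (fun y' => L x y') y

/-- The regularized payoff `L_β(x, y) = L(x, y) - (β / 2) ‖y - y₀‖²` with reference point `y₀`. -/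
def regularized (L : Vec nx → Vec ny → ℝ) (y₀ : Vec ny) (β : ℝ) : Vec nx → Vec ny → ℝ :=
  fun x y => L x y - β / 2 * ‖y - y₀‖ ^ 2

/-- The standing assumptions on the problem `min_{x ∈ X} max_{y ∈ Y} L(x, y)`. -/
structure Problem (X : Set (Vec nx)) (Y : Set (Vec ny)) (L : Vec nx → Vec ny → ℝ)
    (μ Lxx Lyx Lyy : ℝ) : Prop where
  compact_X : IsCompact X
  convex_X : Convex ℝ X
  compact_Y : IsCompact Y
  convex_Y : Convex ℝ Y
  mu_nonneg : 0 ≤ μ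
  strongConcave : ∀ x ∈ X, StrongConcaveOn Y μ (L x)
  contDiff : ∃ U : Set (Vec nx × Vec ny), IsOpen U ∧ X ×ˢ Y ⊆ U ∧
    ContDiffOn ℝ 1 (fun p : Vec nx × Vec ny => L p.1 p.2) U
  Lxx_nonneg : 0 ≤ Lxx
  Lyy_nonneg : 0 ≤ Lyy
  Lyx_pos : 0 < Lyx
  lipschitz_gradX : ∀ x ∈ X, ∀ y ∈ Y, ∀ x' ∈ X, ∀ y' ∈ Y,
    ‖gradX L x y - gradX L x' y'‖ ≤ Lxx * ‖x - x'‖ + Lyx * ‖y - y'‖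
  lipschitz_gradY : ∀ x ∈ X, ∀ y ∈ Y, ∀ x' ∈ X, ∀ y' ∈ Y,
    ‖gradY L x y - gradY L x' y'‖ ≤ Lyx * ‖x - x'‖ + Lyy * ‖y - y'‖

/-- `Y` is an `α`-strongly convex set. -/
def StronglyConvexSet (Y : Set (Vec ny)) (α : ℝ) : Prop :=
  ∀ y ∈ Y, ∀ y' ∈ Y, ∀ z : Vec ny, ‖z‖ = 1 → ∀ ξ ∈ Set.Icc (0 : ℝ) 1,
    ξ • y + (1 - ξ) • y' + (ξ * (1 - ξ) * (α / 2) * ‖y - y'‖ ^ 2) • z ∈ Y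

/-- The set of admissible answers of the linear minimization oracle over `U` in direction `d`,
that is, `argmin_{v ∈ U} ⟨d, v⟩`. -/
def LMO {n : ℕ} (U : Set (Vec n)) (d : Vec n) : Set (Vec n) :=
  {v | v ∈ U ∧ ∀ w ∈ U, inner ℝ d v ≤ inner ℝ d w}

/-- The dual gap `G_Y(x, y) = max_{u ∈ Y} L(x, u) - L(x, y)`. -/
def gapY (Y : Set (Vec ny)) (L : Vec nx → Vec ny → ℝ) (x : Vec nx) (y : Vec ny) : ℝ :=
  sSup ((fun u => L x u) '' Y) - L x y

/-- The Frank–Wolfe gap `G_X(x, y) = max_{v ∈ X} ⟨∇ₓ L(x, y), x - v⟩`. -/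
def gapX (X : Set (Vec nx)) (L : Vec nx → Vec ny → ℝ) (x : Vec nx) (y : Vec ny) : ℝ :=
  sSup ((fun v => inner ℝ (gradX L x y) (x - v)) '' X)

/-- The closed-loop dual stepsize, where `g` is the gradient `∇_y L_β(x, y)` and `u` the oracle
answer. For `u = y` the value is irrelevant, as the step is then `γ • (u - y) = 0`. -/
def dualStep (Lyy β : ℝ) (g y u : Vec ny) : ℝ :=
  min (inner ℝ g (u - y) / ((Lyy + β) * ‖u - y‖ ^ 2)) 1

/-- `(x t, y t)` is a sequence of iterates of the fully projection-free LMO-LMO algorithm with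
stepsizes `τ` and smoothing parameters `β`; the reference point of the regularization is the
initial dual iterate `y 0`. -/
structure IsRun (X : Set (Vec nx)) (Y : Set (Vec ny)) (L : Vec nx → Vec ny → ℝ) (Lyy : ℝ)
    (τ β : ℕ → ℝ) (x : ℕ → Vec nx) (y : ℕ → Vec ny) : Prop where
  init_x : x 0 ∈ X
  init_y : y 0 ∈ Y
  step_x : ∀ t, ∃ v ∈ LMO X (gradX L (x t) (y t)), x (t + 1) = x t + τ t • (v - x t)
  step_y : ∀ t, ∃ u ∈ LMO Y (-gradY (regularized L (y 0) (β t)) (x t) (y t)),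
    y (t + 1) = y t +
      dualStep Lyy (β t) (gradY (regularized L (y 0) (β t)) (x t) (y t)) (y t) u • (u - y t)

/-- Primal stepsizes `τ_t ∈ [0, 1]` with `τ_t = Θ(t^{-a})`. -/
structure IsStepsize (a : ℝ) (τ : ℕ → ℝ) : Prop where
  mem_Icc : ∀ t, τ t ∈ Set.Icc (0 : ℝ) 1
  theta : Asymptotics.IsTheta Filter.atTop τ (fun t : ℕ => (t : ℝ) ^ (-a))

/-- Positive nonincreasing smoothing parameters `β_t = Θ(t^{-b})`. -/
structure IsSmoothing (b : ℝ) (β : ℕ → ℝ) : Prop where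
  pos : ∀ t, 0 < β t
  antitone : Antitone β
  theta : Asymptotics.IsTheta Filter.atTop β (fun t : ℕ => (t : ℝ) ^ (-b))

/-- Along the algorithm with schedules `τ`, `β`, both the average Frank–Wolfe gap in `x` and the
last-iterate dual gap are at most `K (T + 1)^{-r}` for every `T ≥ 0`; the constant `K` depends
neither on `T` nor on the initial point or the choices of the oracles. -/
def HasRate (X : Set (Vec nx)) (Y : Set (Vec ny)) (L : Vec nx → Vec ny → ℝ) (Lyy : ℝ)
    (τ β : ℕ → ℝ) (r : ℝ) : Prop :=
  ∃ K : ℝ, ∀ (x : ℕ → Vec nx) (y : ℕ → Vec ny), IsRun X Y L Lyy τ β x y → ∀ T : ℕ,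
    (1 / ((T : ℝ) + 1)) * ∑ t ∈ Finset.range (T + 1), gapX X L (x t) (y t)
        ≤ K * ((T : ℝ) + 1) ^ (-r) ∧
      gapY Y L (x T) (y T) ≤ K * ((T : ℝ) + 1) ^ (-r)

end

end MinimaxLMO

namespace MinimaxLMO

open Asymptotics Filter

/-! ### Smooth and strongly concave functions on a Hilbert space. -/

section Hilbert

variable {E : Type*} [NormedAddCommGroup E] [InnerProductSpace ℝ E] [CompleteSpace E]

/-! Write `σ_t = μ + β_t`, `h_t` for the dual gap of the regularized payoff at `(x_t, y_t)`, `Φ_t`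
for its maximum over `Y` at `x_t`, and `π_t` for the increase guaranteed by the short dual step.
Everything rests on two recursions (`Estimates`) with the same error `E_t = C (τ_t √(h_t/σ_t) +
τ_t²/σ_t)`: up to the telescoping terms `C β_t`, the gap satisfies `h_{t+1} ≤ h_t - π_t + E_t` and
the primal function `Φ_{t+1} ≤ Φ_t - τ_t G_t + E_t`. The error arises because `σ_t`-strong concavity
puts `y_t` within `O(√(h_t/σ_t) + τ_t/σ_t)` of the maximizer at the next primal point, and the mixed
Lipschitz bound multiplies this distance by the length `O(τ_t)` of the primal step.

The progress satisfies `π_t ≳ h_t²` in general and `π_t ≳ √σ_t h_t^{3/2}` for strongly convex `Y`,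
where the Frank–Wolfe gap dominates the gradient norm. Young's inequality then gives `E_t ≤ π_t/2 +
O(1/t)` if `τ_t = O(t^{-a})`, `σ_t ≳ t^{-b}` and `2a - b ≥ 3/2`, respectively `3a/2 - b ≥ 1`; the
four schedules attain equality.

Adding the recursions cancels `π_t`, so `τ_t G_t` is a difference of the bounded potential `Φ + h +
2Cβ` plus `O(1/t)`; summation by parts (`average_le_of_descent`) bounds the average of `G` by
`O(T^{a-1})`, with `a - 1 = -r`. For the last iterate, `π_t` beats the `O(1/t)` error as soon as
`h_t` exceeds a large multiple of `t^{-r}` (`le_rpow_of_recursion`). Removing the regularization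
costs `O(β_t) = O(t^{-r})`. -/

theorem hasDerivAt_comp_segment {f : E → ℝ} {x d : E} {s : ℝ}
    (hf : DifferentiableAt ℝ f (x + s • d)) :
    HasDerivAt (fun r : ℝ => f (x + r • d)) (inner ℝ (gradient f (x + s • d)) d) s := by
  have h1 : HasDerivAt (fun r : ℝ => x + r • d) d s := by
    simpa using ((hasDerivAt_id s).smul_const d).const_add x
  have h2 := hf.hasFDerivAt.comp_hasDerivAt s h1
  rw [inner_gradient_left]
  exact h2

/-- A first-order Taylor estimate for functions with Lipschitz gradient along a segment. -/
theorem abs_sub_sub_inner_gradient_le {f : E → ℝ} {S : Set E} (hS : Convex ℝ S) {l : ℝ}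
    (hf : ∀ z ∈ S, DifferentiableAt ℝ f z) {x z : E} (hx : x ∈ S) (hz : z ∈ S)
    (hl : ∀ w ∈ S, ‖gradient f w - gradient f x‖ ≤ l * ‖w - x‖) :
    |f z - f x - inner ℝ (gradient f x) (z - x)| ≤ l / 2 * ‖z - x‖ ^ 2 := by
  have hmem : ∀ s ∈ Set.Icc (0 : ℝ) 1, x + s • (z - x) ∈ S := fun s hs =>
    hS.add_smul_sub_mem hx hz hs
  set d := z - x with hd
  let g : ℝ → ℝ := fun s => f (x + s • d) - f x - s * inner ℝ (gradient f x) d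
  have hg : ∀ s ∈ Set.Icc (0 : ℝ) 1, HasDerivAt g
      (inner ℝ (gradient f (x + s • d)) d - inner ℝ (gradient f x) d) s := by
    intro s hs
    have h1 := (hasDerivAt_comp_segment (hf _ (hmem s hs))).sub_const (f x)
    have h2 : HasDerivAt (fun r : ℝ => r * inner ℝ (gradient f x) d)
        (inner ℝ (gradient f x) d) s := by
      simpa using (hasDerivAt_id s).mul_const (inner ℝ (gradient f x) d)
    exact h1.sub h2
  -- The Taylor remainder `g` vanishes at `0` and `|g'(s)| ≤ l ‖d‖² s`, so it stays below the
  -- primitive of this bound.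
  have key := image_norm_le_of_norm_deriv_right_le_deriv_boundary (f := g) (a := 0) (b := 1)
    (B := fun s => l * ‖d‖ ^ 2 / 2 * s ^ 2) (B' := fun s => l * ‖d‖ ^ 2 * s)
    (fun s hs => (hg s hs).continuousAt.continuousWithinAt)
    (fun s hs => (hg s (Set.Ico_subset_Icc_self hs)).hasDerivWithinAt)
    (by simp [g])
    (fun s => ((hasDerivAt_pow 2 s).const_mul (l * ‖d‖ ^ 2 / 2)).congr_deriv
      (by push_cast; ring))
    (fun s hs => by
      have hs' := Set.Ico_subset_Icc_self hs
      rw [← inner_sub_left]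
      calc ‖inner ℝ (gradient f (x + s • d) - gradient f x) d‖
          ≤ ‖gradient f (x + s • d) - gradient f x‖ * ‖d‖ := norm_inner_le_norm _ _
        _ ≤ l * ‖x + s • d - x‖ * ‖d‖ := by gcongr; exact hl _ (hmem s hs')
        _ = l * ‖d‖ ^ 2 * s := by
          rw [add_sub_cancel_left, norm_smul, Real.norm_of_nonneg hs'.1]; ring)
    (Set.right_mem_Icc.2 zero_le_one)
  simp only [g, one_smul, one_mul, one_pow, mul_one, Real.norm_eq_abs] at key
  have hxz : x + d = z := by rw [hd]; abel
  rw [hxz] at key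
  linarith

/-- The difference `f - g` is Lipschitz on a convex set when the gradients differ by at most `C`. -/
theorem abs_sub_sub_sub_le_of_norm_gradient_sub_le {f g : E → ℝ} {S : Set E} (hS : Convex ℝ S)
    {C : ℝ} (hf : ∀ z ∈ S, DifferentiableAt ℝ f z) (hg : ∀ z ∈ S, DifferentiableAt ℝ g z)
    (hC : ∀ z ∈ S, ‖gradient f z - gradient g z‖ ≤ C) {x z : E} (hx : x ∈ S) (hz : z ∈ S) :
    |(f z - g z) - (f x - g x)| ≤ C * ‖z - x‖ := by
  have := Convex.norm_image_sub_le_of_norm_fderiv_le (𝕜 := ℝ) (f := f - g) (C := C)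
    (fun w hw => (hf w hw).sub (hg w hw)) (fun w hw => by
      rw [fderiv_sub (hf w hw) (hg w hw), ← toDual_gradient, ← toDual_gradient, ← map_sub,
        LinearIsometryEquiv.norm_map]
      exact hC w hw) hS hx hz
  simpa using this

/-- Divide the strong concavity inequality on the segment from `y` to `u` by its parameter and let
the parameter tend to `0`. -/
theorem _root_.StrongConcaveOn.le_add_inner_gradient {f : E → ℝ} {S : Set E} {m : ℝ}
    (hf : StrongConcaveOn S m f) {y u : E} (hy : y ∈ S) (hu : u ∈ S)
    (hd : DifferentiableAt ℝ f y) :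
    f u ≤ f y + inner ℝ (gradient f y) (u - y) - m / 2 * ‖u - y‖ ^ 2 := by
  have h0 : DifferentiableAt ℝ f (y + (0 : ℝ) • (u - y)) := by simpa using hd
  have h1 := (hasDerivAt_comp_segment h0).tendsto_slope_zero_right
  simp only [zero_add, zero_smul, add_zero] at h1
  have h2 : Filter.Tendsto (fun t : ℝ => f u - f y + (1 - t) * (m / 2 * ‖u - y‖ ^ 2))
      (nhdsWithin 0 (Set.Ioi 0)) (nhds (f u - f y + (1 - 0) * (m / 2 * ‖u - y‖ ^ 2))) := by
    apply Filter.Tendsto.mono_left _ nhdsWithin_le_nhds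
    apply Continuous.tendsto
    fun_prop
  have h3 := le_of_tendsto_of_tendsto h2 h1 (by
    filter_upwards [Ioo_mem_nhdsGT (zero_lt_one' ℝ)] with t ht
    have := hf.2 hu hy ht.1.le (sub_nonneg.2 ht.2.le) (by ring)
    have he : t • u + (1 - t) • y = y + t • (u - y) := by module
    rw [he] at this
    simp only [smul_eq_mul] at this ⊢
    rw [inv_mul_eq_div, le_div_iff₀ ht.1]
    linarith)
  linarith

-- Quadratic growth away from a maximizer, by the same limit along the segment from `u` to `y`; no
-- differentiability is needed.
omit [CompleteSpace E] in
theorem _root_.StrongConcaveOn.le_sub_of_isMaxOn {f : E → ℝ} {S : Set E} {m : ℝ}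
    (hf : StrongConcaveOn S m f) {y u : E} (hy : y ∈ S) (hu : u ∈ S) (hmax : IsMaxOn f S u) :
    m / 2 * ‖u - y‖ ^ 2 ≤ f u - f y := by
  have h2 : Filter.Tendsto (fun t : ℝ => (1 - t) * (m / 2 * ‖u - y‖ ^ 2))
      (nhdsWithin 0 (Set.Ioi 0)) (nhds ((1 - 0) * (m / 2 * ‖u - y‖ ^ 2))) := by
    apply Filter.Tendsto.mono_left _ nhdsWithin_le_nhds
    apply Continuous.tendsto
    fun_prop
  have h3 := le_of_tendsto h2 (b := f u - f y) (by
    filter_upwards [Ioo_mem_nhdsGT (zero_lt_one' ℝ)] with t ht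
    have h4 := hf.2 hy hu ht.1.le (sub_nonneg.2 ht.2.le) (by ring)
    have h5 := hmax (hf.1 hy hu ht.1.le (sub_nonneg.2 ht.2.le) (by ring))
    simp only [smul_eq_mul, Set.mem_ofPred_eq] at h4 h5
    rw [norm_sub_rev y u] at h4
    refine le_of_mul_le_mul_left ?_ ht.1
    linarith)
  linarith

/-- A Polyak–Łojasiewicz inequality: maximize the quadratic upper model over `‖u - y‖`. It turns a
large dual gap into a large gradient. -/
theorem _root_.StrongConcaveOn.two_mul_sub_le_norm_gradient_sq {f : E → ℝ} {S : Set E} {m : ℝ}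
    (hm : 0 ≤ m) (hf : StrongConcaveOn S m f) {y u : E} (hy : y ∈ S) (hu : u ∈ S)
    (hd : DifferentiableAt ℝ f y) :
    2 * m * (f u - f y) ≤ ‖gradient f y‖ ^ 2 := by
  have h1 := hf.le_add_inner_gradient hy hu hd
  have h2 := real_inner_le_norm (gradient f y) (u - y)
  nlinarith [sq_nonneg (‖gradient f y‖ - m * ‖u - y‖)]

omit [CompleteSpace E] in
/-- The strong concavity modulus of `f` grows by `β` upon subtracting `β / 2 ‖· - y₀‖²`. -/
theorem _root_.StrongConcaveOn.sub_norm_sq {f : E → ℝ} {S : Set E} {m : ℝ}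
    (hf : StrongConcaveOn S m f) (y₀ : E) (β : ℝ) :
    StrongConcaveOn S (m + β) (fun y => f y - β / 2 * ‖y - y₀‖ ^ 2) := by
  refine ⟨hf.1, fun u hu y hy a b ha hb hab => ?_⟩
  have h1 := hf.2 hu hy ha hb hab
  have hb' : b = 1 - a := by linarith
  have h2 : ‖a • u + b • y - y₀‖ ^ 2
      = a * ‖u - y₀‖ ^ 2 + b * ‖y - y₀‖ ^ 2 - a * b * ‖u - y‖ ^ 2 := by
    have e1 : a • u + b • y - y₀ = a • (u - y₀) + b • (y - y₀) := by
      rw [hb']; module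
    have e2 : u - y = (u - y₀) - (y - y₀) := by abel
    rw [e1, e2, norm_add_sq_real, norm_sub_sq_real (u - y₀) (y - y₀), norm_smul, norm_smul, inner_smul_left,
      inner_smul_right, mul_pow, mul_pow, hb']
    simp only [Real.norm_eq_abs, sq_abs, conj_trivial]
    ring
  simp only [smul_eq_mul] at h1 ⊢
  rw [h2]
  linarith

theorem hasGradientAt_sub_norm_sq {f : E → ℝ} {y : E} (hf : DifferentiableAt ℝ f y)
    (y₀ : E) (β : ℝ) :
    HasGradientAt (fun y => f y - β / 2 * ‖y - y₀‖ ^ 2) (gradient f y - β • (y - y₀)) y := by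
  rw [hasGradientAt_iff_hasFDerivAt]
  have h1 : HasFDerivAt (fun y : E => ‖y - y₀‖ ^ 2) _ y :=
    ((hasFDerivAt_id y).sub_const y₀).norm_sq
  have h2 := hf.hasFDerivAt.sub (h1.const_mul (β / 2))
  refine h2.congr_fderiv ?_
  ext w
  rw [← toDual_gradient]
  simp
  ring

/-- The progress of a Frank–Wolfe ascent step with the short-step rule. -/
theorem add_half_le_of_shortStep {f : E → ℝ} {S : Set E} (hS : Convex ℝ S) {M : ℝ} (hM : 0 ≤ M)
    (hf : ∀ z ∈ S, DifferentiableAt ℝ f z) {y u : E} (hy : y ∈ S) (hu : u ∈ S)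
    (hl : ∀ w ∈ S, ‖gradient f w - gradient f y‖ ≤ M * ‖w - y‖) {γ : ℝ}
    (hγ : γ = min (inner ℝ (gradient f y) (u - y) / (M * ‖u - y‖ ^ 2)) 1)
    (hp : 0 ≤ inner ℝ (gradient f y) (u - y)) :
    y + γ • (u - y) ∈ S ∧
    f y + γ * inner ℝ (gradient f y) (u - y) / 2 ≤ f (y + γ • (u - y)) := by
  set p := inner ℝ (gradient f y) (u - y) with hpd
  have hγ0 : 0 ≤ γ := by rw [hγ]; exact le_min (by positivity) zero_le_one
  have hγ1 : γ ≤ 1 := by rw [hγ]; exact min_le_right _ _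
  have hmem : y + γ • (u - y) ∈ S := hS.add_smul_sub_mem hy hu ⟨hγ0, hγ1⟩
  refine ⟨hmem, ?_⟩
  have h1 := (abs_le.1 (abs_sub_sub_inner_gradient_le hS hf hy hmem hl)).1
  rw [add_sub_cancel_left, inner_smul_right, norm_smul, Real.norm_of_nonneg hγ0, mul_pow,
    ← hpd] at h1
  have h2 : γ * (M * ‖u - y‖ ^ 2) ≤ p := by
    have h3 : γ ≤ p / (M * ‖u - y‖ ^ 2) := by rw [hγ]; exact min_le_left _ _
    rcases (by positivity : 0 ≤ M * ‖u - y‖ ^ 2).eq_or_lt with h | h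
    · rw [← h, mul_zero]; exact hp
    · exact (le_div_iff₀ h).1 h3
  nlinarith [mul_le_mul_of_nonneg_left h2 hγ0]

/-- If the short-step rule degenerates at a strongly concave function, then `y` is optimal. -/
theorem le_of_shortStep_degenerate {f : E → ℝ} {S : Set E} (hS : Convex ℝ S) {M m : ℝ}
    (hm : 0 < m) (hsc : StrongConcaveOn S m f)
    (hf : ∀ z ∈ S, DifferentiableAt ℝ f z) {y u w : E} (hy : y ∈ S) (hu : u ∈ S)
    (hl : ∀ w ∈ S, ‖gradient f w - gradient f y‖ ≤ M * ‖w - y‖)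
    (hdeg : M * ‖u - y‖ ^ 2 = 0)
    (hw : f w - f y ≤ inner ℝ (gradient f y) (u - y)) :
    f w ≤ f y := by
  -- If `M = 0`, the first-order model is exact at `u`, which strong concavity allows only for `u =
  -- y`.
  rcases mul_eq_zero.1 hdeg with h | h
  · have h1 := (abs_le.1 (abs_sub_sub_inner_gradient_le hS hf hy hu hl)).1
    have h2 := hsc.le_add_inner_gradient hy hu (hf y hy)
    rw [h] at h1
    have h3 : ‖u - y‖ ^ 2 ≤ 0 := by nlinarith
    have h4 : u - y = 0 := by
      rw [← norm_eq_zero]; exact pow_eq_zero_iff two_ne_zero |>.1 (le_antisymm h3 (by positivity))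
    rw [h4, inner_zero_right] at hw
    linarith
  · have h4 : u - y = 0 := by
      rw [← norm_eq_zero]; exact pow_eq_zero_iff two_ne_zero |>.1 h
    rw [h4, inner_zero_right] at hw
    linarith

end Hilbert

/-! ### Scalar lower bounds on the progress of one short step. -/

/-- In a strongly convex set, the Frank–Wolfe gap dominates the gradient norm. -/
theorem StronglyConvexSet.norm_mul_sq_le {n : ℕ} {Y : Set (Vec n)} {α : ℝ}
    (hY : StronglyConvexSet Y α) {g y u : Vec n} (hy : y ∈ Y) (hu : u ∈ LMO Y (-g)) :
    α / 4 * ‖u - y‖ ^ 2 * ‖g‖ ≤ inner ℝ g (u - y) := by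
  by_cases hg : g = 0
  · simp [hg]
  have hg' : 0 < ‖g‖ := norm_pos_iff.2 hg
  have hz : ‖(‖g‖⁻¹ • g)‖ = 1 := by
    rw [norm_smul, norm_inv, norm_norm, inv_mul_cancel₀ hg'.ne']
  -- The competitor is the midpoint of `u` and `y` pushed by `α / 8 * ‖u - y‖ ^ 2` in the direction
  -- of `g`.
  have h1 := hu.2 _ (hY u hu.1 y hy _ hz (1 / 2) ⟨by norm_num, by norm_num⟩)
  simp only [inner_neg_left, inner_add_right, inner_smul_right, real_inner_self_eq_norm_sq,
    inner_sub_right] at h1 ⊢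
  have h2 : ‖g‖⁻¹ * ‖g‖ ^ 2 = ‖g‖ := by field_simp
  rw [mul_neg ‖g‖⁻¹, h2] at h1
  linarith

/-- Sublinear progress of the short step. -/
theorem sq_le_half_shortStep {p q h H M' D' : ℝ} (hH : 0 < H) (hq : 0 ≤ q)
    (hqD : q ≤ M' * D') (h0 : 0 ≤ h) (hhH : h ≤ H) (hp : h ≤ p) (hdeg : q = 0 → h = 0) :
    1 / (2 * (H + M' * D')) * h ^ 2 ≤ min (p / q) 1 * p / 2 := by
  have hpos : 0 < H + M' * D' := by linarith
  -- For `q = 0` the quotient `p / q` is `0` by convention and the step makes no progress; `hdeg`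
  -- covers this case.
  rcases hq.eq_or_lt with h1 | h1
  · rw [hdeg h1.symm, ← h1]; simp
  rw [div_mul_eq_mul_div, one_mul, div_le_iff₀ (by positivity)]
  have h2 : 0 ≤ p := h0.trans hp
  rcases min_cases (p / q) 1 with ⟨h3, -⟩ | ⟨h3, -⟩ <;> rw [h3]
  · have : p / q * p / 2 * (2 * (H + M' * D')) = p ^ 2 * ((H + M' * D') / q) := by
      field_simp
    rw [this]
    have h4 : 1 ≤ (H + M' * D') / q := by rw [le_div_iff₀ h1]; linarith
    nlinarith [pow_le_pow_left₀ h0 hp 2, sq_nonneg p]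
  · nlinarith [mul_le_mul hhH hp h0 hH.le, mul_nonneg h2 (hq.trans hqD)]

/-- Faster progress of the short step when the gap dominates the gradient norm; here
`q = M ‖u - y‖²` and `d = ‖u - y‖²`. -/
theorem sqrt_mul_le_half_shortStep {p M d h H σ σ' M' α N : ℝ} (hα : 0 < α) (hσ : 0 < σ)
    (hσ' : σ ≤ σ') (hM : 0 ≤ M) (hMM : M ≤ M') (hM' : 0 < M') (hd : 0 ≤ d) (h0 : 0 ≤ h)
    (hhH : h ≤ H) (hp : h ≤ p) (hdeg : M * d = 0 → h = 0) (hpN : α / 4 * d * N ≤ p)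
    (hN : 0 ≤ N) (hN2 : 2 * σ * h ≤ N ^ 2) :
    1 / (2 * Real.sqrt (σ' * H) + 8 * M' / α) * (Real.sqrt σ * Real.sqrt h * h)
      ≤ min (p / (M * d)) 1 * p / 2 := by
  have hpos : 0 < 2 * Real.sqrt (σ' * H) + 8 * M' / α := by positivity
  rcases (by positivity : 0 ≤ M * d).eq_or_lt with h1 | h1
  · rw [hdeg h1.symm, ← h1]; simp
  rw [div_mul_eq_mul_div, one_mul, div_le_iff₀ hpos, ← Real.sqrt_mul hσ.le]
  have h2 : 0 ≤ p := h0.trans hp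
  have hM0 : 0 < M := lt_of_le_of_ne hM (by rintro rfl; simp at h1)
  have hd0 : 0 < d := lt_of_le_of_ne hd (by rintro rfl; simp at h1)
  rcases min_cases (p / (M * d)) 1 with ⟨h3, -⟩ | ⟨h3, -⟩ <;> rw [h3]
  · have h4 : Real.sqrt (σ * h) ≤ N := by
      apply Real.sqrt_le_iff.2 ⟨hN, by nlinarith [mul_nonneg hσ.le h0]⟩
    -- Since `p ≥ α d N / 4`, an unclipped stepsize is at least a multiple of the gradient norm `N`,
    -- which is at least `√(2σh)`.
    have h5 : α / (4 * M') * N ≤ p / (M * d) := by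
      rw [le_div_iff₀ h1, div_mul_eq_mul_div, div_mul_eq_mul_div, div_le_iff₀ (by positivity)]
      have : α * N * (M * d) ≤ α * N * (M' * d) := by gcongr
      nlinarith
    calc Real.sqrt (σ * h) * h ≤ N * p := by gcongr
      _ = α / (4 * M') * N * p / 2 * (8 * M' / α) := by field_simp; ring
      _ ≤ p / (M * d) * p / 2 * (8 * M' / α) := by gcongr
      _ ≤ _ := by gcongr; linarith [Real.sqrt_nonneg (σ' * H)]
  · have h6 : Real.sqrt (σ * h) ≤ Real.sqrt (σ' * H) := by
      apply Real.sqrt_le_sqrt; gcongr; linarith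
    have h7 : Real.sqrt (σ * h) * h ≤ Real.sqrt (σ' * H) * p := by gcongr
    have h8 : 0 ≤ 8 * M' / α * p := by positivity
    linarith

/-- Solves the quadratic inequality that arises for the distance `s` to a maximizer. -/
theorem le_of_half_sq_le_add {s σ h l : ℝ} (hσ : 0 < σ) (h0 : 0 ≤ h) (hl : 0 ≤ l)
    (hs : σ / 2 * s ^ 2 ≤ h + l * s) : s ≤ 2 * Real.sqrt (h / σ) + 2 * l / σ := by
  by_contra! hc
  set A := Real.sqrt (h / σ)
  have hA : σ * A ^ 2 = h := by
    rw [Real.sq_sqrt (by positivity)]; field_simp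
  have hA0 : 0 ≤ A := Real.sqrt_nonneg _
  have hB : σ * (2 * l / σ) = 2 * l := by field_simp
  set B := 2 * l / σ with hBd
  have hB0 : 0 ≤ B := by positivity
  have h1 : s * (s - B) ≤ 2 * A ^ 2 := by
    refine le_of_mul_le_mul_left ?_ hσ
    nlinarith
  have h2 : (2 * A) * (2 * A) < s * (s - B) ∨ A = 0 := by
    by_cases hA1 : A = 0
    · exact Or.inr hA1
    · left
      have : 0 < A := lt_of_le_of_ne hA0 (Ne.symm hA1)
      nlinarith
  rcases h2 with h2 | h2
  · nlinarith [sq_nonneg A]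
  · rw [h2] at h1 hc
    nlinarith

/-! ### Effect of a single primal step, dual step or change of `β`. -/

variable {nx ny : ℕ} {X : Set (Vec nx)} {Y : Set (Vec ny)} {L : Vec nx → Vec ny → ℝ}
  {μ Lxx Lyx Lyy : ℝ}

theorem isMaxOn_sSup_image {n : ℕ} {f : Vec n → ℝ} {S : Set (Vec n)} {u : Vec n} (hu : u ∈ S)
    (h : IsMaxOn f S u) : sSup (f '' S) = f u :=
  IsGreatest.csSup_eq ⟨Set.mem_image_of_mem f hu, by rintro _ ⟨w, hw, rfl⟩; exact h hw⟩

theorem gapY_eq {F : Vec nx → Vec ny → ℝ} {x : Vec nx} {u : Vec ny} (hu : u ∈ Y)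
    (h : IsMaxOn (F x) Y u) (y : Vec ny) : gapY Y F x y = F x u - F x y := by
  have := isMaxOn_sSup_image hu h
  simp only [gapY]
  rw [← this]

namespace Problem

variable (hP : Problem X Y L μ Lxx Lyx Lyy)
include hP

theorem differentiableAt_uncurried {x : Vec nx} {y : Vec ny} (hx : x ∈ X) (hy : y ∈ Y) :
    DifferentiableAt ℝ (fun p : Vec nx × Vec ny => L p.1 p.2) (x, y) := by
  obtain ⟨U, hU, hXY, hL⟩ := hP.contDiff
  exact (hL.contDiffAt (hU.mem_nhds (hXY ⟨hx, hy⟩))).differentiableAt one_ne_zero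

theorem differentiableAt_left {x : Vec nx} {y : Vec ny} (hx : x ∈ X) (hy : y ∈ Y) :
    DifferentiableAt ℝ (fun x' => L x' y) x :=
  DifferentiableAt.comp (f := fun x' => (x', y)) x (hP.differentiableAt_uncurried hx hy)
    (differentiableAt_id.prodMk (differentiableAt_const y))

theorem differentiableAt_right {x : Vec nx} {y : Vec ny} (hx : x ∈ X) (hy : y ∈ Y) :
    DifferentiableAt ℝ (L x) y :=
  DifferentiableAt.comp (f := fun y' => (x, y')) y (hP.differentiableAt_uncurried hx hy)
    ((differentiableAt_const x).prodMk differentiableAt_id)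

theorem hasGradientAt_regularized {x : Vec nx} {y : Vec ny} (hx : x ∈ X) (hy : y ∈ Y)
    (y₀ : Vec ny) (β : ℝ) :
    HasGradientAt (regularized L y₀ β x) (gradY L x y - β • (y - y₀)) y :=
  hasGradientAt_sub_norm_sq (hP.differentiableAt_right hx hy) y₀ β

theorem strongConcaveOn_regularized {x : Vec nx} (hx : x ∈ X) (y₀ : Vec ny) (β : ℝ) :
    StrongConcaveOn Y (μ + β) (regularized L y₀ β x) :=
  (hP.strongConcave x hx).sub_norm_sq y₀ β

theorem norm_gradient_regularized_sub_le {x : Vec nx} {y w : Vec ny} (hx : x ∈ X) (hy : y ∈ Y)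
    (hw : w ∈ Y) (y₀ : Vec ny) {β : ℝ} (hβ : 0 ≤ β) :
    ‖gradient (regularized L y₀ β x) w - gradient (regularized L y₀ β x) y‖
      ≤ (Lyy + β) * ‖w - y‖ := by
  rw [(hP.hasGradientAt_regularized hx hw y₀ β).gradient,
    (hP.hasGradientAt_regularized hx hy y₀ β).gradient]
  have h1 := hP.lipschitz_gradY x hx w hw x hx y hy
  rw [sub_self, norm_zero, mul_zero, zero_add] at h1
  have e : gradY L x w - β • (w - y₀) - (gradY L x y - β • (y - y₀))
      = (gradY L x w - gradY L x y) - β • (w - y) := by module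
  rw [e]
  refine (norm_sub_le _ _).trans ?_
  rw [norm_smul, Real.norm_of_nonneg hβ]
  linarith

theorem exists_isMaxOn_regularized (hY : Y.Nonempty) {x : Vec nx} (hx : x ∈ X)
    (y₀ : Vec ny) (β : ℝ) : ∃ u ∈ Y, IsMaxOn (regularized L y₀ β x) Y u :=
  hP.compact_Y.exists_isMaxOn hY fun _ hy =>
    (hP.hasGradientAt_regularized hx hy y₀ β).differentiableAt.continuousAt.continuousWithinAt

/-- The regularization cancels between the two sides, and `L · u - L · y` is Lipschitz in `x` with
constant `Lyx * ‖u - y‖`. -/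
theorem regularized_sub_le {x x' : Vec nx} {u y : Vec ny} (hx : x ∈ X) (hx' : x' ∈ X)
    (hu : u ∈ Y) (hy : y ∈ Y) (y₀ : Vec ny) (β : ℝ) :
    regularized L y₀ β x' u - regularized L y₀ β x' y
      ≤ regularized L y₀ β x u - regularized L y₀ β x y + Lyx * ‖x' - x‖ * ‖u - y‖ := by
  have := (abs_le.1 (abs_sub_sub_sub_le_of_norm_gradient_sub_le hP.convex_X
    (f := fun x => L x u) (g := fun x => L x y) (C := Lyx * ‖u - y‖)
    (fun z hz => hP.differentiableAt_left hz hu) (fun z hz => hP.differentiableAt_left hz hy)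
    (fun z hz => by
      have := hP.lipschitz_gradX z hz u hu z hz y hy
      simpa [gradX] using this) hx hx')).2
  simp only [regularized]
  linarith

theorem gapY_regularized_nonneg {x : Vec nx} {y : Vec ny} (hx : x ∈ X) (hy : y ∈ Y)
    (y₀ : Vec ny) (β : ℝ) : 0 ≤ gapY Y (regularized L y₀ β) x y := by
  obtain ⟨u, hu, hmax⟩ := hP.exists_isMaxOn_regularized ⟨y, hy⟩ hx y₀ β
  rw [gapY_eq hu hmax]
  exact sub_nonneg.2 (hmax hy)

/-- The distance of `y` to the maximizer at a perturbed primal point. -/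
theorem norm_maximizer_sub_le {x x' : Vec nx} {u y : Vec ny} (hx : x ∈ X) (hx' : x' ∈ X)
    (hu : u ∈ Y) (hy : y ∈ Y) {y₀ : Vec ny} {β δ : ℝ} (hσ : 0 < μ + β) (hδ : ‖x' - x‖ ≤ δ)
    (hmax : IsMaxOn (regularized L y₀ β x') Y u) :
    ‖u - y‖ ≤ 2 * Real.sqrt (gapY Y (regularized L y₀ β) x y / (μ + β))
      + 2 * (Lyx * δ) / (μ + β) := by
  have hL := hP.Lyx_pos
  have hδ0 : 0 ≤ δ := (norm_nonneg _).trans hδ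
  refine le_of_half_sq_le_add hσ (hP.gapY_regularized_nonneg hx hy y₀ β) (by positivity) ?_
  have h1 := (hP.strongConcaveOn_regularized hx' y₀ β).le_sub_of_isMaxOn hy hu hmax
  have h2 := hP.regularized_sub_le hx hx' hu hy y₀ β
  obtain ⟨w, hw, hwmax⟩ := hP.exists_isMaxOn_regularized ⟨y, hy⟩ hx y₀ β
  rw [gapY_eq hw hwmax]
  have h3 : regularized L y₀ β x u ≤ regularized L y₀ β x w := hwmax hu
  have h4 : Lyx * ‖x' - x‖ * ‖u - y‖ ≤ Lyx * δ * ‖u - y‖ := by gcongr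
  linarith

theorem gapY_regularized_le_of_primal_step {x x' : Vec nx} {y : Vec ny} (hx : x ∈ X)
    (hx' : x' ∈ X) (hy : y ∈ Y) {y₀ : Vec ny} {β δ : ℝ} (hσ : 0 < μ + β) (hδ : ‖x' - x‖ ≤ δ) :
    gapY Y (regularized L y₀ β) x' y ≤ gapY Y (regularized L y₀ β) x y
      + Lyx * δ * (2 * Real.sqrt (gapY Y (regularized L y₀ β) x y / (μ + β))
      + 2 * (Lyx * δ) / (μ + β)) := by
  have hL := hP.Lyx_pos
  have hδ0 : 0 ≤ δ := (norm_nonneg _).trans hδ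
  obtain ⟨u, hu, hmax⟩ := hP.exists_isMaxOn_regularized ⟨y, hy⟩ hx' y₀ β
  have h1 := hP.norm_maximizer_sub_le hx hx' hu hy hσ hδ hmax
  have h2 := hP.regularized_sub_le hx hx' hu hy y₀ β
  have h4 : Lyx * ‖x' - x‖ * ‖u - y‖ ≤ Lyx * δ * (2 * Real.sqrt
      (gapY Y (regularized L y₀ β) x y / (μ + β)) + 2 * (Lyx * δ) / (μ + β)) := by gcongr
  refine le_trans ?_ (add_le_add_right h4 _)
  obtain ⟨w, hw, hwmax⟩ := hP.exists_isMaxOn_regularized ⟨y, hy⟩ hx y₀ β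
  rw [gapY_eq hu hmax, gapY_eq hw hwmax]
  have h3 : regularized L y₀ β x u ≤ regularized L y₀ β x w := hwmax hu
  linarith

/-- Freezing the maximizer `u` at the new point `x'` reduces the claim to the descent lemma for `L ·
u`, so the maximum function itself need not be differentiated. Replacing the gradient at `u` by the
one at `y` costs `Lyx * ‖u - y‖ * ‖x' - x‖`. -/
theorem sSup_regularized_le_of_primal_step {x x' : Vec nx} {y : Vec ny} (hx : x ∈ X)
    (hx' : x' ∈ X) (hy : y ∈ Y) {y₀ : Vec ny} {β δ : ℝ} (hσ : 0 < μ + β) (hδ : ‖x' - x‖ ≤ δ) :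
    sSup (regularized L y₀ β x' '' Y) ≤ sSup (regularized L y₀ β x '' Y)
      + inner ℝ (gradX L x y) (x' - x)
      + Lyx * δ * (2 * Real.sqrt (gapY Y (regularized L y₀ β) x y / (μ + β))
      + 2 * (Lyx * δ) / (μ + β)) + Lxx / 2 * δ ^ 2 := by
  have hL := hP.Lyx_pos
  have hL' := hP.Lxx_nonneg
  have hδ0 : 0 ≤ δ := (norm_nonneg _).trans hδ
  obtain ⟨u, hu, hmax⟩ := hP.exists_isMaxOn_regularized ⟨y, hy⟩ hx' y₀ β
  obtain ⟨w, hw, hwmax⟩ := hP.exists_isMaxOn_regularized ⟨y, hy⟩ hx y₀ β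
  rw [isMaxOn_sSup_image hu hmax, isMaxOn_sSup_image hw hwmax]
  have h1 := hP.norm_maximizer_sub_le hx hx' hu hy hσ hδ hmax
  have h3 : regularized L y₀ β x u ≤ regularized L y₀ β x w := hwmax hu
  have h5 := (abs_le.1 (abs_sub_sub_inner_gradient_le hP.convex_X (f := fun x => L x u)
    (l := Lxx) (fun z hz => hP.differentiableAt_left hz hu) hx hx' (fun z hz => by
      have := hP.lipschitz_gradX z hz u hu x hx u hu
      simpa [gradX] using this))).2
  have h6 : inner ℝ (gradX L x u) (x' - x) ≤ inner ℝ (gradX L x y) (x' - x)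
      + Lyx * ‖u - y‖ * ‖x' - x‖ := by
    rw [← sub_le_iff_le_add', ← inner_sub_left]
    refine (real_inner_le_norm _ _).trans ?_
    gcongr
    have := hP.lipschitz_gradX x hx u hu x hx y hy
    simpa using this
  have h4 : Lyx * ‖u - y‖ * ‖x' - x‖ ≤ Lyx * (2 * Real.sqrt
      (gapY Y (regularized L y₀ β) x y / (μ + β)) + 2 * (Lyx * δ) / (μ + β)) * δ := by gcongr
  have h7 : Lxx / 2 * ‖x' - x‖ ^ 2 ≤ Lxx / 2 * δ ^ 2 := by gcongr
  have h8 : regularized L y₀ β x' u - regularized L y₀ β x u = L x' u - L x u := by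
    simp only [regularized]; ring
  have h9 : inner ℝ (gradX L x u) (x' - x)
    = inner ℝ (gradient (fun x => L x u) x) (x' - x) := rfl
  linarith

theorem sSup_regularized_le_of_le {x : Vec nx} (hx : x ∈ X) (hY : Y.Nonempty) {y₀ : Vec ny}
    {β β' D : ℝ} (hβ : β' ≤ β) (hD : ∀ u ∈ Y, ‖u - y₀‖ ≤ D) :
    sSup (regularized L y₀ β' x '' Y)
      ≤ sSup (regularized L y₀ β x '' Y) + (β - β') / 2 * D ^ 2 := by
  obtain ⟨u, hu, hmax⟩ := hP.exists_isMaxOn_regularized hY hx y₀ β'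
  obtain ⟨w, hw, hwmax⟩ := hP.exists_isMaxOn_regularized hY hx y₀ β
  rw [isMaxOn_sSup_image hu hmax, isMaxOn_sSup_image hw hwmax]
  have h3 : regularized L y₀ β x u ≤ regularized L y₀ β x w := hwmax hu
  have h4 : (β - β') / 2 * ‖u - y₀‖ ^ 2 ≤ (β - β') / 2 * D ^ 2 := by
    have := sub_nonneg.2 hβ
    gcongr
    exact hD u hu
  simp only [regularized] at h3 ⊢
  linarith

theorem gapY_regularized_le_of_le {x : Vec nx} {y : Vec ny} (hx : x ∈ X) (hy : y ∈ Y)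
    {y₀ : Vec ny} {β β' D : ℝ} (hβ : β' ≤ β) (hD : ∀ u ∈ Y, ‖u - y₀‖ ≤ D) :
    gapY Y (regularized L y₀ β') x y
      ≤ gapY Y (regularized L y₀ β) x y + (β - β') / 2 * D ^ 2 := by
  have h1 := hP.sSup_regularized_le_of_le hx ⟨y, hy⟩ hβ hD
  have h2 : 0 ≤ (β - β') / 2 * ‖y - y₀‖ ^ 2 := by
    have := sub_nonneg.2 hβ
    positivity
  have h3 : regularized L y₀ β x y
      = regularized L y₀ β' x y - (β - β') / 2 * ‖y - y₀‖ ^ 2 := by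
    simp only [regularized]; ring
  change sSup (regularized L y₀ β' x '' Y) - _ ≤ sSup (regularized L y₀ β x '' Y) - _ + _
  linarith

/-- One dual Frank–Wolfe step: feasibility, progress, and lower bounds on the progress. -/
theorem dual_step {x : Vec nx} {y u y₀ : Vec ny} {β : ℝ} (hx : x ∈ X) (hy : y ∈ Y)
    (hβ : 0 ≤ β) (hσ : 0 < μ + β) (hu : u ∈ LMO Y (-gradY (regularized L y₀ β) x y))
    {γ p : ℝ} (hγ : γ = dualStep Lyy β (gradY (regularized L y₀ β) x y) y u)
    (hp : p = inner ℝ (gradY (regularized L y₀ β) x y) (u - y)) :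
    y + γ • (u - y) ∈ Y ∧ 0 ≤ γ * p / 2 ∧
    gapY Y (regularized L y₀ β) x (y + γ • (u - y))
      ≤ gapY Y (regularized L y₀ β) x y - γ * p / 2 ∧
    (∀ H β' D, gapY Y (regularized L y₀ β) x y ≤ H → 0 < H → β ≤ β' → ‖u - y‖ ≤ D →
      gapY Y (regularized L y₀ β) x y ^ 2 ≤ (2 * (H + (Lyy + β') * D ^ 2)) * (γ * p / 2)) ∧
    (∀ H β' α, gapY Y (regularized L y₀ β) x y ≤ H → 0 < H → β ≤ β' → 0 < Lyy + β' → 0 < α →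
      StronglyConvexSet Y α →
      Real.sqrt (μ + β) * Real.sqrt (gapY Y (regularized L y₀ β) x y)
        * gapY Y (regularized L y₀ β) x y
        ≤ (2 * Real.sqrt ((μ + β') * H) + 8 * (Lyy + β') / α) * (γ * p / 2)) := by
  set F := regularized L y₀ β with hF
  have hLyy := hP.Lyy_nonneg
  have hM : 0 ≤ Lyy + β := by linarith
  have hdiff : ∀ z ∈ Y, DifferentiableAt ℝ (F x) z := fun z hz =>
    (hP.hasGradientAt_regularized hx hz y₀ β).differentiableAt
  have hlip : ∀ w ∈ Y, ‖gradient (F x) w - gradient (F x) y‖ ≤ (Lyy + β) * ‖w - y‖ :=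
    fun w hw => hP.norm_gradient_regularized_sub_le hx hy hw y₀ hβ
  have hsc := hP.strongConcaveOn_regularized hx y₀ β
  obtain ⟨w, hw, hwmax⟩ := hP.exists_isMaxOn_regularized ⟨y, hy⟩ hx y₀ β
  have hg : gradY F x y = gradient (F x) y := rfl
  rw [hg] at hp hγ
  -- By concavity, the Frank–Wolfe gap `p` dominates the true gap.
  have hgap : gapY Y F x y ≤ p := by
    rw [gapY_eq hw hwmax, hp]
    have h1 := hsc.le_add_inner_gradient hy hw (hdiff y hy)
    have h2 := hu.2 w hw
    rw [hg] at h2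
    simp only [inner_neg_left, inner_sub_right] at h1 h2 ⊢
    have h3 : 0 ≤ (μ + β) / 2 * ‖w - y‖ ^ 2 := by positivity
    linarith
  have h0 : 0 ≤ gapY Y F x y := hP.gapY_regularized_nonneg hx hy y₀ β
  have hp0 : 0 ≤ p := h0.trans hgap
  have hγ' : γ = min (p / ((Lyy + β) * ‖u - y‖ ^ 2)) 1 := by rw [hγ, dualStep, hp]
  have hγ0 : 0 ≤ γ := by rw [hγ']; exact le_min (by positivity) zero_le_one
  obtain ⟨hmem, hprog⟩ := add_half_le_of_shortStep hP.convex_Y hM hdiff hy hu.1 hlip hγ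
    (hp ▸ hp0)
  have hdeg : (Lyy + β) * ‖u - y‖ ^ 2 = 0 → gapY Y F x y = 0 := by
    intro hd
    refine le_antisymm ?_ h0
    rw [gapY_eq hw hwmax] at hgap ⊢
    exact sub_nonpos.2 (le_of_shortStep_degenerate hP.convex_Y hσ hsc hdiff hy hu.1 hlip hd
      (by rw [← hp]; exact hgap))
  refine ⟨hmem, by positivity, ?_, ?_, ?_⟩
  · rw [gapY_eq hw hwmax, gapY_eq hw hwmax, hp]
    linarith
  · intro H β' D hH hH0 hβ' hD
    have hq : (Lyy + β) * ‖u - y‖ ^ 2 ≤ (Lyy + β') * D ^ 2 := by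
      have : 0 ≤ Lyy + β' := by linarith
      gcongr
    have hq0 : 0 ≤ (Lyy + β) * ‖u - y‖ ^ 2 := by positivity
    have h1 := sq_le_half_shortStep hH0 hq0 hq h0 hH hgap hdeg
    rw [← hγ', div_mul_eq_mul_div, one_mul, div_le_iff₀ (by linarith)] at h1
    linarith
  · intro H β' α hH hH0 hβ' hM' hα hYα
    have hN2 := hsc.two_mul_sub_le_norm_gradient_sq hσ.le hy hw (hdiff y hy)
    rw [← hF, ← gapY_eq hw hwmax] at hN2
    have hpN := hYα.norm_mul_sq_le hy hu
    rw [hg, ← hp] at hpN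
    have h1 := sqrt_mul_le_half_shortStep hα hσ (add_le_add_right hβ' μ) hM
      (add_le_add_right hβ' Lyy) hM' (sq_nonneg ‖u - y‖) h0 hH hgap hdeg hpN (norm_nonneg _) hN2
    rw [← hγ', div_mul_eq_mul_div, one_mul, div_le_iff₀ (by positivity)] at h1
    linarith

theorem exists_abs_le : ∃ B, ∀ x ∈ X, ∀ y ∈ Y, |L x y| ≤ B := by
  obtain ⟨B, hB⟩ := (hP.compact_X.prod hP.compact_Y).exists_bound_of_continuousOn
    (f := fun p : Vec nx × Vec ny => L p.1 p.2) (fun p hp =>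
      (hP.differentiableAt_uncurried hp.1 hp.2).continuousAt.continuousWithinAt)
  exact ⟨B, fun x hx y hy => hB (x, y) ⟨hx, hy⟩⟩

theorem exists_diameter : ∃ D, 0 < D ∧ (∀ x ∈ X, ∀ x' ∈ X, ‖x - x'‖ ≤ D) ∧
    ∀ y ∈ Y, ∀ y' ∈ Y, ‖y - y'‖ ≤ D := by
  obtain ⟨a, ha⟩ := Metric.isBounded_iff.1 hP.compact_X.isBounded
  obtain ⟨b, hb⟩ := Metric.isBounded_iff.1 hP.compact_Y.isBounded
  refine ⟨|a| + |b| + 1, by positivity, fun x hx x' hx' => ?_, fun y hy y' hy' => ?_⟩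
  · rw [← dist_eq_norm]
    linarith [ha hx hx', le_abs_self a, abs_nonneg b]
  · rw [← dist_eq_norm]
    linarith [hb hy hy', le_abs_self b, abs_nonneg a]

theorem exists_norm_gradX_le : ∃ N, 0 ≤ N ∧ ∀ x ∈ X, ∀ y ∈ Y, ‖gradX L x y‖ ≤ N := by
  rcases (X ×ˢ Y).eq_empty_or_nonempty with h | ⟨⟨x₁, y₁⟩, hx₁, hy₁⟩
  · exact ⟨0, le_rfl, fun x hx y hy => (Set.notMem_empty (x, y) (h ▸ ⟨hx, hy⟩)).elim⟩
  obtain ⟨D, hD0, hDX, hDY⟩ := hP.exists_diameter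
  have h1 := hP.Lxx_nonneg
  have h2 := hP.Lyx_pos
  refine ⟨‖gradX L x₁ y₁‖ + (Lxx * D + Lyx * D), by positivity, fun x hx y hy => ?_⟩
  have h3 := hP.lipschitz_gradX x hx y hy x₁ hx₁ y₁ hy₁
  have h4 : Lxx * ‖x - x₁‖ + Lyx * ‖y - y₁‖ ≤ Lxx * D + Lyx * D := by
    gcongr
    exacts [hDX x hx x₁ hx₁, hDY y hy y₁ hy₁]
  have h5 := norm_sub_norm_le (gradX L x y) (gradX L x₁ y₁)
  linarith

end Problem

/-! ### The recursive estimates along a run. -/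

theorem gapX_nonneg {D : ℝ} (hD : ∀ x ∈ X, ∀ x' ∈ X, ‖x - x'‖ ≤ D) {x : Vec nx} (hx : x ∈ X)
    (y : Vec ny) : 0 ≤ gapX X L x y := by
  refine le_csSup ⟨‖gradX L x y‖ * D, ?_⟩ ⟨x, hx, by simp⟩
  rintro _ ⟨v, hv, rfl⟩
  exact (real_inner_le_norm _ _).trans (by gcongr; exact hD x hx v hv)

theorem gapX_le_inner {x v : Vec nx} {y : Vec ny} (hx : x ∈ X) (hv : v ∈ LMO X (gradX L x y)) :
    gapX X L x y ≤ inner ℝ (gradX L x y) (x - v) := by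
  refine csSup_le ⟨_, x, hx, rfl⟩ ?_
  rintro _ ⟨w, hw, rfl⟩
  have := hv.2 w hw
  simp only [inner_sub_right]
  linarith

/-- The recursive estimates satisfied along a run: `G` is the Frank–Wolfe gap, `h` the smoothed
dual gap, `π` the progress of the dual steps and `Φ` the smoothed primal function. -/
structure Estimates (μ : ℝ) (τ β : ℕ → ℝ) (C : ℝ) (G h π Φ : ℕ → ℝ) : Prop where
  h_nonneg : ∀ t, 0 ≤ h t
  h_le : ∀ t, h t ≤ C
  abs_Φ_le : ∀ t, |Φ t| ≤ C
  G_nonneg : ∀ t, 0 ≤ G t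
  G_le : ∀ t, G t ≤ C
  π_nonneg : ∀ t, 0 ≤ π t
  dual : ∀ t, h (t + 1) + C * β (t + 1) ≤ h t + C * β t - π t
    + C * (τ t * Real.sqrt (h t / (μ + β t)) + τ t ^ 2 / (μ + β t))
  primal : ∀ t, Φ (t + 1) + C * β (t + 1) ≤ Φ t + C * β t - τ t * G t
    + C * (τ t * Real.sqrt (h t / (μ + β t)) + τ t ^ 2 / (μ + β t))

theorem regularized_zero (L : Vec nx → Vec ny → ℝ) (y₀ : Vec ny) : regularized L y₀ 0 = L := by
  funext x y
  simp [regularized]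

theorem IsRun.mem (hP : Problem X Y L μ Lxx Lyx Lyy) {τ β : ℕ → ℝ}
    (hβ0 : ∀ t, 0 ≤ β t) (hσ : ∀ t, 0 < μ + β t) (hτ : ∀ t, τ t ∈ Set.Icc (0 : ℝ) 1)
    {x : ℕ → Vec nx} {y : ℕ → Vec ny} (h : IsRun X Y L Lyy τ β x y) (t : ℕ) :
    x t ∈ X ∧ y t ∈ Y := by
  induction t with
  | zero => exact ⟨h.init_x, h.init_y⟩
  | succ t ih =>
    obtain ⟨v, hv, hxv⟩ := h.step_x t
    obtain ⟨u, hu, hyu⟩ := h.step_y t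
    refine ⟨hxv ▸ hP.convex_X.add_smul_sub_mem ih.1 hv.1 (hτ t), hyu ▸ ?_⟩
    exact (hP.dual_step ih.1 ih.2 (hβ0 t) (hσ t) hu rfl rfl).1

/-- The constant is chosen before the run, from compactness and `β 0` alone; this gives the
uniformity in the initial point and the oracle answers. -/
theorem Problem.exists_estimates (hP : Problem X Y L μ Lxx Lyx Lyy) {τ β : ℕ → ℝ}
    (hβ0 : ∀ t, 0 ≤ β t) (hβ : Antitone β) (hσ : ∀ t, 0 < μ + β t)
    (hτ : ∀ t, τ t ∈ Set.Icc (0 : ℝ) 1) :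
    ∃ C, 0 < C ∧ ∀ x y, IsRun X Y L Lyy τ β x y → ∃ h π Φ : ℕ → ℝ,
      Estimates μ τ β C (fun t => gapX X L (x t) (y t)) h π Φ ∧
      (∀ t, gapY Y L (x t) (y t) ≤ h t + C * β t) ∧
      (∀ t, h t ^ 2 ≤ C * π t) ∧
      ∀ α, 0 < α → StronglyConvexSet Y α → ∀ t,
        Real.sqrt (μ + β t) * Real.sqrt (h t) * h t ≤ (C + C / α) * π t := by
  obtain ⟨B, hB⟩ := hP.exists_abs_le
  obtain ⟨D, hD0, hDX, hDY⟩ := hP.exists_diameter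
  obtain ⟨N, hN0, hN⟩ := hP.exists_norm_gradX_le
  have hμ := hP.mu_nonneg
  have hLxx := hP.Lxx_nonneg
  have hLyx := hP.Lyx_pos
  have hLyy := hP.Lyy_nonneg
  have hb0 := hβ0 0
  -- The summand `1` keeps `Lyy + b` positive even if `Lyy` and all `β t` vanish.
  set b := β 0 + 1 with hb
  have hb' : 0 < b := by linarith
  have hβb : ∀ t, β t ≤ b := fun t => (hβ (Nat.zero_le t)).trans (by linarith)
  set H := 2 * |B| + b / 2 * D ^ 2 + 1 with hH
  have hH0 : 0 < H := by positivity
  set a := Lyx * D with ha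
  have ha0 : 0 < a := by positivity
  -- A sum of nonnegative terms, each group dominating one constant needed below.
  obtain ⟨C, hC⟩ : ∃ C, C = H + N * D + D ^ 2 + (2 * a + 2 * a ^ 2 + Lxx / 2 * D ^ 2 * (μ + b))
    + 2 * (H + (Lyy + b) * D ^ 2) + 2 * Real.sqrt ((μ + b) * H) + 8 * (Lyy + b) := ⟨_, rfl⟩
  have c1 : 0 ≤ N * D := by positivity
  have c2 : 0 ≤ D ^ 2 := by positivity
  have c3 : 0 ≤ a ^ 2 := by positivity
  have c4 : 0 ≤ Lxx / 2 * D ^ 2 * (μ + b) := by positivity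
  have c5 : 0 ≤ (Lyy + b) * D ^ 2 := by positivity
  have c6 : 0 ≤ Real.sqrt ((μ + b) * H) := by positivity
  have c7 : 0 ≤ Lyy + b := by positivity
  have hC0 : 0 < C := by rw [hC]; linarith
  refine ⟨C, hC0, fun x y hrun => ?_⟩
  have hmem := fun t => hrun.mem hP hβ0 hσ hτ t
  have hx := fun t => (hmem t).1
  have hy := fun t => (hmem t).2
  choose v hv hxv using hrun.step_x
  choose u hu hyu using hrun.step_y
  set F : ℕ → Vec nx → Vec ny → ℝ := fun t => regularized L (y 0) (β t) with hF
  have hdual := fun t => hP.dual_step (hx t) (hy t) (hβ0 t) (hσ t) (hu t) rfl rfl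
  set h : ℕ → ℝ := fun t => gapY Y (F t) (x t) (y t) with hh
  set Φ : ℕ → ℝ := fun t => sSup (F t (x t) '' Y) with hΦ
  have hh0 : ∀ t, 0 ≤ h t := fun t => hP.gapY_regularized_nonneg (hx t) (hy t) _ _
  have hFB : ∀ t, ∀ w ∈ Y, |F t (x t) w| ≤ |B| + b / 2 * D ^ 2 := by
    intro t w hw
    have h1 := (hB (x t) (hx t) w hw).trans (le_abs_self B)
    have h2 : β t / 2 * ‖w - y 0‖ ^ 2 ≤ b / 2 * D ^ 2 := by
      have := hβb t
      have := hDY w hw _ (hy 0)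
      gcongr
    have h3 : 0 ≤ β t / 2 * ‖w - y 0‖ ^ 2 := by have := hβ0 t; positivity
    have h4 := abs_le.1 h1
    simp only [hF, regularized]
    rw [abs_le]
    constructor <;> linarith
  have hhH : ∀ t, h t ≤ H := by
    intro t
    obtain ⟨w, hw, hwmax⟩ := hP.exists_isMaxOn_regularized ⟨_, hy 0⟩ (hx t) (y 0) (β t)
    have h1 : h t = F t (x t) w - F t (x t) (y t) := gapY_eq hw hwmax _
    have h2 := (hB (x t) (hx t) w hw).trans (le_abs_self B)
    have h3 := (hB (x t) (hx t) (y t) (hy t)).trans (le_abs_self B)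
    have h4 : β t / 2 * ‖y t - y 0‖ ^ 2 ≤ b / 2 * D ^ 2 := by
      have := hβb t
      have := hDY _ (hy t) _ (hy 0)
      gcongr
    have h5 : 0 ≤ β t / 2 * ‖w - y 0‖ ^ 2 := by have := hβ0 t; positivity
    rw [h1]
    simp only [hF, regularized]
    linarith [(abs_le.1 h2).2, (abs_le.1 h3).1]
  have hDy : ∀ w ∈ Y, ‖w - y 0‖ ≤ D := fun w hw => hDY w hw _ (hy 0)
  have hstep : ∀ t, ‖x (t + 1) - x t‖ ≤ τ t * D := by
    intro t
    rw [hxv t, add_sub_cancel_left, norm_smul, Real.norm_of_nonneg (hτ t).1]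
    exact mul_le_mul_of_nonneg_left (hDX _ (hv t).1 _ (hx t)) (hτ t).1
  have hβC : ∀ t, (β t - β (t + 1)) / 2 * D ^ 2 ≤ C * β t - C * β (t + 1) := by
    intro t
    have h1 : D ^ 2 ≤ C := by rw [hC]; linarith
    have h2 := sub_nonneg.2 (hβ (Nat.le_succ t))
    nlinarith [mul_le_mul_of_nonneg_left h1 h2]
  -- The free `r` serves both recursions: the dual one involves the smaller gap after the dual step,
  -- the primal one `h t` itself.
  have herr : ∀ t r, r ≤ Real.sqrt (h t / (μ + β t)) →
      Lyx * (τ t * D) * (2 * r + 2 * (Lyx * (τ t * D)) / (μ + β t)) + Lxx / 2 * (τ t * D) ^ 2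
      ≤ C * (τ t * Real.sqrt (h t / (μ + β t)) + τ t ^ 2 / (μ + β t)) := by
    intro t r hr
    set q := Real.sqrt (h t / (μ + β t))
    have hq : 0 ≤ q := Real.sqrt_nonneg _
    have hτ0 := (hτ t).1
    have hσt := hσ t
    have e1 : Lyx * (τ t * D) * (2 * r + 2 * (Lyx * (τ t * D)) / (μ + β t))
        = 2 * a * (τ t * r) + 2 * a ^ 2 * (τ t ^ 2 / (μ + β t)) := by
      rw [ha]; ring
    have e2 : Lxx / 2 * (τ t * D) ^ 2 ≤ Lxx / 2 * D ^ 2 * (μ + b) * (τ t ^ 2 / (μ + β t)) := by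
      have : Lxx / 2 * (τ t * D) ^ 2
          = Lxx / 2 * D ^ 2 * (μ + β t) * (τ t ^ 2 / (μ + β t)) := by field_simp
      rw [this]
      have := hβb t
      gcongr
    have e3 : 2 * a * (τ t * r) ≤ 2 * a * (τ t * q) := by gcongr
    have e4 : 2 * a * (τ t * q) ≤ C * (τ t * q) := by
      gcongr
      rw [hC]; linarith
    have e5 : (2 * a ^ 2 + Lxx / 2 * D ^ 2 * (μ + b)) * (τ t ^ 2 / (μ + β t))
        ≤ C * (τ t ^ 2 / (μ + β t)) := by
      gcongr
      rw [hC]; linarith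
    rw [e1]
    linarith
  set π : ℕ → ℝ := fun t => dualStep Lyy (β t) (gradY (F t) (x t) (y t)) (y t) (u t)
    * inner ℝ (gradY (F t) (x t) (y t)) (u t - y t) / 2 with hπ
  have hπ0 : ∀ t, 0 ≤ π t := fun t => (hdual t).2.1
  have hplus : ∀ t, gapY Y (F t) (x t) (y (t + 1)) ≤ h t - π t := fun t => by
    rw [hyu t]; exact (hdual t).2.2.1
  refine ⟨h, π, Φ, ⟨hh0, fun t => (hhH t).trans (by rw [hC]; linarith), ?_,
    fun t => gapX_nonneg hDX (hx t) _, ?_, hπ0, ?_, ?_⟩, ?_, ?_, ?_⟩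
  · intro t
    obtain ⟨w, hw, hwmax⟩ := hP.exists_isMaxOn_regularized ⟨_, hy 0⟩ (hx t) (y 0) (β t)
    have h1 : Φ t = F t (x t) w := isMaxOn_sSup_image hw hwmax
    rw [h1]
    refine (hFB t w hw).trans ?_
    rw [hC]
    linarith [abs_nonneg B]
  · intro t
    refine (gapX_le_inner (hx t) (hv t)).trans ((real_inner_le_norm _ _).trans ?_)
    have h1 : ‖gradX L (x t) (y t)‖ * ‖x t - v t‖ ≤ N * D := by
      gcongr
      exacts [hN _ (hx t) _ (hy t), hDX _ (hx t) _ (hv t).1]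
    rw [hC]; linarith
  · intro t
    -- The iteration is split into the dual step at `x t`, the primal move at fixed `y (t + 1)`, and
    -- the decrease of `β`.
    have h1 := hP.gapY_regularized_le_of_primal_step (hx t) (hx (t + 1)) (hy (t + 1))
      (y₀ := y 0) (hσ t) (hstep t)
    have h2 : h (t + 1) ≤ _ := hP.gapY_regularized_le_of_le (hx (t + 1)) (hy (t + 1))
      (y₀ := y 0) (hβ (Nat.le_succ t)) hDy
    have h3 := herr t (Real.sqrt (gapY Y (F t) (x t) (y (t + 1)) / (μ + β t))) (by
      apply Real.sqrt_le_sqrt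
      have := hσ t
      gcongr
      linarith [hplus t, hπ0 t])
    have h4 := hplus t
    have h5 := hβC t
    have h6 : 0 ≤ Lxx / 2 * (τ t * D) ^ 2 := by positivity
    simp only [hF] at h3 h4
    linarith
  · intro t
    -- Here the dual point is `y t`, at which the oracle gradient was evaluated.
    have h1 := hP.sSup_regularized_le_of_primal_step (hx t) (hx (t + 1)) (hy t)
      (y₀ := y 0) (hσ t) (hstep t)
    have h2 : Φ (t + 1) ≤ _ := hP.sSup_regularized_le_of_le (hx (t + 1)) ⟨_, hy 0⟩
      (y₀ := y 0) (hβ (Nat.le_succ t)) hDy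
    have h3 := herr t _ le_rfl
    have h4 : inner ℝ (gradX L (x t) (y t)) (x (t + 1) - x t)
        ≤ -(τ t * gapX X L (x t) (y t)) := by
      have := mul_le_mul_of_nonneg_left (gapX_le_inner (hx t) (hv t)) (hτ t).1
      rw [hxv t, add_sub_cancel_left, inner_smul_right]
      rw [inner_sub_right] at this ⊢
      linarith
    have h5 := hβC t
    simp only [hh, hF, hΦ] at h2 h3 ⊢
    linarith
  · intro t
    have h1 := hP.gapY_regularized_le_of_le (hx t) (hy t) (y₀ := y 0) (hβ0 t) hDy
    rw [regularized_zero] at h1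
    refine h1.trans ?_
    have h2 : D ^ 2 ≤ C := by rw [hC]; linarith
    have h3 : D ^ 2 * β t ≤ C * β t := mul_le_mul_of_nonneg_right h2 (hβ0 t)
    have h4 : 0 ≤ D ^ 2 * β t := mul_nonneg c2 (hβ0 t)
    simp only [hh, hF]
    linarith
  · intro t
    refine ((hdual t).2.2.2.1 H b D (hhH t) hH0 (hβb t) (hDY _ (hu t).1 _ (hy t))).trans ?_
    refine mul_le_mul_of_nonneg_right ?_ (hπ0 t)
    rw [hC]; linarith
  · intro α hα hYα t
    refine ((hdual t).2.2.2.2 H b α (hhH t) hH0 (hβb t) (by linarith) hα hYα).trans ?_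
    refine mul_le_mul_of_nonneg_right ?_ (hπ0 t)
    refine add_le_add (by rw [hC]; linarith) ?_
    gcongr
    rw [hC]; linarith

/-! ### Real sequences: powers, descent sums, recursions and Young-type inequalities. -/

theorem rpow_neg_le_succ {r n : ℝ} (hr0 : 0 ≤ r) (hr1 : r ≤ 1) (hn : 1 ≤ n) :
    n ^ (-r) ≤ (n + 1) ^ (-r) * (1 + 1 / n) := by
  have hn0 : 0 < n := by linarith
  have h1 : (n + 1) ^ r ≤ n ^ r * (1 + 1 / n) := by
    have e : n + 1 = n * (1 + 1 / n) := by field_simp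
    have hi : 0 ≤ 1 / n := by positivity
    rw [e, Real.mul_rpow hn0.le (by positivity)]
    gcongr
    refine (rpow_one_add_le_one_add_mul_self (by linarith) hr0 hr1).trans ?_
    nlinarith
  rw [Real.rpow_neg hn0.le, Real.rpow_neg (by linarith), inv_mul_eq_div,
    le_div_iff₀ (by positivity), inv_mul_le_iff₀ (by positivity)]
  exact h1

theorem rpow_neg_le_two_mul_succ {r n : ℝ} (hr0 : 0 ≤ r) (hr1 : r ≤ 1) (hn : 1 ≤ n) :
    n ^ (-r) ≤ 2 * (n + 1) ^ (-r) := by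
  have h1 := rpow_neg_le_succ hr0 hr1 hn
  have h2 : 1 / n ≤ 1 := by rw [div_le_one (by linarith)]; exact hn
  have h3 : 0 ≤ (n + 1) ^ (-r) := by positivity
  nlinarith

theorem rpow_neg_le_succ_add {r n : ℝ} (hr0 : 0 ≤ r) (hr1 : r ≤ 1) (hn : 1 ≤ n) :
    n ^ (-r) ≤ (n + 1) ^ (-r) + 1 / n := by
  have h1 := rpow_neg_le_succ hr0 hr1 hn
  have h2 : 0 ≤ 1 / n := by positivity
  have h3 : (n + 1) ^ (-r) ≤ 1 :=
    Real.rpow_le_one_of_one_le_of_nonpos (by linarith) (by linarith)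
  nlinarith

theorem one_div_le_rpow_neg {r n : ℝ} (hr1 : r ≤ 1) (hn : 1 ≤ n) : 1 / n ≤ n ^ (-r) := by
  rw [one_div, ← Real.rpow_neg_one]
  exact Real.rpow_le_rpow_of_exponent_le hn (by linarith)

/-- Discrete comparison with the integral: Bernoulli's inequality `(1 - 1/n)^a ≤ 1 - a/n` drives the
induction. -/
theorem sum_range_rpow_sub_one_le {a : ℝ} (ha0 : 0 < a) (ha1 : a ≤ 1) (N : ℕ) :
    ∑ t ∈ Finset.range N, ((t : ℝ) + 1) ^ (a - 1) ≤ (N : ℝ) ^ a / a := by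
  induction N with
  | zero => simp [Real.zero_rpow ha0.ne']
  | succ N ih =>
    rw [Finset.sum_range_succ]
    refine (add_le_add_left ih _).trans ?_
    push_cast
    set n := (N : ℝ) + 1 with hn
    have hN : (0 : ℝ) ≤ N := N.cast_nonneg
    have hn0 : 0 < n := by linarith
    have h1 : (N : ℝ) ^ a ≤ n ^ a * (1 + a * (-(1 / n))) := by
      have hi : 1 / n ≤ 1 := by rw [div_le_one hn0]; linarith
      have e : (N : ℝ) = n * (1 + -(1 / n)) := by field_simp; linarith
      rw [e, Real.mul_rpow hn0.le (by linarith)]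
      gcongr
      exact rpow_one_add_le_one_add_mul_self (by linarith) ha0.le ha1
    rw [le_div_iff₀ ha0, add_mul, div_mul_cancel₀ _ ha0.ne', Real.rpow_sub_one hn0.ne']
    calc (N : ℝ) ^ a + n ^ a / n * a ≤ n ^ a * (1 + a * (-(1 / n))) + n ^ a / n * a := by gcongr
      _ = n ^ a := by ring

/-- Summation by parts against the increasing weights `(t + 1)^a`. -/
theorem sum_range_rpow_mul_sub_le {a B : ℝ} (ha : 0 ≤ a) {P : ℕ → ℝ} (hP : ∀ t, P t ≤ B)
    (N : ℕ) :
    ∑ t ∈ Finset.range N, ((t : ℝ) + 1) ^ a * (P t - P (t + 1)) ≤ (N : ℝ) ^ a * (B - P N) := by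
  induction N with
  | zero =>
    simp only [Finset.range_zero, Finset.sum_empty]
    exact mul_nonneg (by positivity) (sub_nonneg.2 (hP 0))
  | succ N ih =>
    rw [Finset.sum_range_succ]
    have h1 : (N : ℝ) ^ a * (B - P N) ≤ ((N : ℝ) + 1) ^ a * (B - P N) := by
      have := sub_nonneg.2 (hP N)
      gcongr
      linarith
    push_cast
    linarith

/-- If `τ_t G_t ≤ P_t - P_{t+1} + O(1/t)` with `P` bounded and `τ_t ≳ t^{-a}`, then the average of
`G` is `O(t^{a-1})`. -/
theorem average_le_of_descent {a c B C g : ℝ} (ha0 : 0 < a) (ha1 : a ≤ 1) (hc : 0 < c)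
    (hC : 0 ≤ C) (hg : 0 ≤ g) (hB : 0 ≤ B) {t₀ : ℕ} {τ : ℕ → ℝ}
    (hτ : ∀ t ≥ t₀, c * ((t : ℝ) + 1) ^ (-a) ≤ τ t) :
    ∃ K, ∀ G P : ℕ → ℝ, (∀ t, 0 ≤ G t) → (∀ t, G t ≤ g) → (∀ t, |P t| ≤ B) →
      (∀ t, τ t * G t ≤ P t - P (t + 1) + C / ((t : ℝ) + 1)) →
      ∀ T : ℕ, (1 / ((T : ℝ) + 1)) * ∑ t ∈ Finset.range (T + 1), G t
        ≤ K * ((T : ℝ) + 1) ^ (a - 1) := by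
  set A := C / c + (2 * B / c + g) * t₀ with hA
  have hA0 : 0 ≤ A := by positivity
  refine ⟨2 * B / c + A / a, fun G P hG0 hGg hPB hdesc T => ?_⟩
  have hpt : ∀ t : ℕ, G t ≤ 1 / c * (((t : ℝ) + 1) ^ a * (P t - P (t + 1)))
      + A * ((t : ℝ) + 1) ^ (a - 1) := by
    intro t
    set n := (t : ℝ) + 1 with hn
    have ht0 : (0 : ℝ) ≤ t := t.cast_nonneg
    have hn1 : 1 ≤ n := by linarith
    have hn0 : 0 < n := by linarith
    have hna : 0 < n ^ a := by positivity
    have hna1 : n ^ (a - 1) = n ^ a / n := Real.rpow_sub_one hn0.ne' a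
    rcases le_or_gt t₀ t with ht | ht
    · have h1 := mul_le_mul_of_nonneg_right (hτ t ht) (hG0 t)
      have h2 := h1.trans (hdesc t)
      rw [← hn, Real.rpow_neg hn0.le] at h2
      have h3 : G t ≤ n ^ a / c * (P t - P (t + 1) + C / n) := by
        have := mul_le_mul_of_nonneg_left h2 (by positivity : 0 ≤ n ^ a / c)
        have e : n ^ a / c * (c * (n ^ a)⁻¹ * G t) = G t := by field_simp
        rwa [e] at this
      have h4 : n ^ a / c * (P t - P (t + 1) + C / n)
          = 1 / c * (n ^ a * (P t - P (t + 1))) + C / c * n ^ (a - 1) := by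
        rw [hna1]; ring
      have h5 : C / c * n ^ (a - 1) ≤ A * n ^ (a - 1) := by
        gcongr
        rw [hA]
        have : 0 ≤ (2 * B / c + g) * t₀ := by positivity
        linarith
      linarith
    -- Before `t₀` the stepsize may vanish, so `G t ≤ g` is used; the term `(2 * B / c + g) * t₀` in
    -- `A` pays for these finitely many indices.
    · have hnt : n ≤ t₀ := by
        rw [hn]; exact_mod_cast ht
      have h1 : -(2 * B) ≤ P t - P (t + 1) := by
        linarith [(abs_le.1 (hPB t)).1, (abs_le.1 (hPB (t + 1))).2]
      have h2 : 1 / c * (n ^ a * (-(2 * B))) ≤ 1 / c * (n ^ a * (P t - P (t + 1))) := by gcongr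
      have h3 : (2 * B / c + g) * n ^ a ≤ A * n ^ (a - 1) := by
        have : (2 * B / c + g) * n ^ a = (2 * B / c + g) * n * n ^ (a - 1) := by
          rw [hna1]; field_simp
        rw [this]
        gcongr
        calc (2 * B / c + g) * n ≤ (2 * B / c + g) * t₀ := by gcongr
          _ ≤ A := by rw [hA]; have : 0 ≤ C / c := by positivity
                      linarith
      have h4 : g ≤ g * n ^ a := le_mul_of_one_le_right hg (Real.one_le_rpow hn1 ha0.le)
      have h5 := hGg t
      have h6 : 1 / c * (n ^ a * (-(2 * B))) = -(2 * B / c * n ^ a) := by ring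
      linarith
  have hT : (0 : ℝ) < (T : ℝ) + 1 := by positivity
  have hsum := Finset.sum_le_sum fun t (_ : t ∈ Finset.range (T + 1)) => hpt t
  rw [Finset.sum_add_distrib, ← Finset.mul_sum, ← Finset.mul_sum] at hsum
  have h1 := sum_range_rpow_mul_sub_le ha0.le (fun t => (abs_le.1 (hPB t)).2) (T + 1)
  have h2 := sum_range_rpow_sub_one_le ha0 ha1 (T + 1)
  push_cast at h1 h2
  have h3 : ((T : ℝ) + 1) ^ a * (B - P (T + 1)) ≤ ((T : ℝ) + 1) ^ a * (2 * B) := by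
    gcongr
    linarith [(abs_le.1 (hPB (T + 1))).1]
  have h4 : ∑ t ∈ Finset.range (T + 1), G t
      ≤ 1 / c * (((T : ℝ) + 1) ^ a * (2 * B)) + A * (((T : ℝ) + 1) ^ a / a) := by
    refine hsum.trans (add_le_add ?_ ?_)
    · gcongr; exact h1.trans h3
    · gcongr
  rw [Real.rpow_sub_one hT.ne', one_div_mul_eq_div, ← mul_div_assoc,
    div_le_div_iff_of_pos_right hT]
  refine h4.trans (le_of_eq ?_)
  ring

/-- A recursion `H_{t+1} ≤ H_t - π_t / 2 + O(1/t)` in which `π_t` is large whenever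
`h_t ≳ t^{-r}` forces `H_t = O(t^{-r})`. -/
theorem le_rpow_of_recursion {r c B C : ℝ} (hr0 : 0 ≤ r) (hr1 : r ≤ 1) (hc : 0 < c)
    (hC : 0 ≤ C) (hB : 0 ≤ B) :
    ∃ K, ∀ h δ π : ℕ → ℝ, (∀ t, 0 ≤ π t) → (∀ t : ℕ, δ t ≤ B * ((t : ℝ) + 1) ^ (-r)) →
      h 0 + δ 0 ≤ C →
      (∀ t : ℕ, h (t + 1) + δ (t + 1) ≤ h t + δ t - π t / 2 + C / ((t : ℝ) + 1)) →
      (∀ (t : ℕ) (m : ℝ), 1 ≤ m → m ^ 2 * ((t : ℝ) + 1) ^ (-r) ≤ h t →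
        c * m ^ 3 / ((t : ℝ) + 1) ≤ π t) →
      ∀ t : ℕ, h t + δ t ≤ K * ((t : ℝ) + 1) ^ (-r) := by
  -- The progress grows like `m ^ 3` but the target only like `m ^ 2`, so a large `m` gives `8 * m ^
  -- 2 + C ≤ c * m ^ 3 / 2`.
  set m := 1 + B + C + 2 * (C + 8) / c with hm
  have hq : 0 ≤ 2 * (C + 8) / c := by positivity
  have hm1 : 1 ≤ m := by linarith
  have hmm : m ≤ m ^ 2 := by nlinarith
  have hcm : 2 * (C + 8) ≤ c * m := by
    have : c * (2 * (C + 8) / c) = 2 * (C + 8) := by field_simp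
    have h2 : c * (2 * (C + 8) / c) ≤ c * m := by gcongr; linarith
    linarith
  have hcm3 : 8 * m ^ 2 + C ≤ c * m ^ 3 / 2 := by
    have : 2 * (C + 8) * m ^ 2 ≤ c * m * m ^ 2 := by gcongr
    nlinarith
  refine ⟨8 * m ^ 2, fun h δ π hπ hδ h0 hrec hgrow t => ?_⟩
  induction t with
  | zero =>
    simp only [Nat.cast_zero, zero_add, Real.one_rpow, mul_one]
    linarith
  | succ t ih =>
    push_cast
    have ht0 : (0 : ℝ) ≤ t := t.cast_nonneg
    have hr := hrec t
    have hd := hδ t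
    have hg := hgrow t m hm1
    set n := (t : ℝ) + 1 with hn
    have hn1 : 1 ≤ n := by linarith
    have hn0 : 0 < n := by linarith
    have f1 := rpow_neg_le_two_mul_succ hr0 hr1 hn1
    have f2 := rpow_neg_le_succ_add hr0 hr1 hn1
    have f3 := one_div_le_rpow_neg hr1 hn1
    have f4 : 0 ≤ 1 / n := by positivity
    set p := n ^ (-r)
    set p' := (n + 1) ^ (-r)
    have hp : 0 ≤ p := f4.trans f3
    have e1 : C / n = C * (1 / n) := by ring
    -- Well below the target, one step cannot overshoot it, since `p ≤ 2 * p'`. Otherwise `h t ≥ m ^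
    -- 2 * p`, and the progress outweighs the error plus the decrease of the target, at most `8 * m
    -- ^ 2 / n`.
    rcases le_or_gt (h t + δ t) (2 * m ^ 2 * p) with hcase | hcase
    · have g1 : C * (1 / n) ≤ m ^ 2 * p := by
        gcongr
        linarith
      have g2 : m ^ 2 * p ≤ m ^ 2 * (2 * p') := by gcongr
      have g3 : 0 ≤ m ^ 2 * p := by positivity
      have := hπ t
      linarith
    · have g1 : B * p ≤ m ^ 2 * p := by
        gcongr
        linarith
      have g2 := hg (by linarith)
      have g3 : (8 * m ^ 2 + C) * (1 / n) ≤ c * m ^ 3 / 2 * (1 / n) := by gcongr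
      have g4 : 8 * m ^ 2 * p ≤ 8 * m ^ 2 * (p' + 1 / n) := by gcongr
      have e2 : c * m ^ 3 / n = 2 * (c * m ^ 3 / 2 * (1 / n)) := by ring
      linarith

/-- Young's inequality with exponents `4/3` and `4`, by splitting at `s = l * e`. It is applied with
`s = √h` and `e = n^{-1/4}`. -/
theorem exists_mul_le_quartic {A ε : ℝ} (hA : 0 ≤ A) (hε : 0 < ε) :
    ∃ K, 0 ≤ K ∧ ∀ q s e : ℝ, 0 ≤ s → 0 ≤ e → q ≤ A * e ^ 3 → q * s ≤ ε * s ^ 4 + K * e ^ 4 := by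
  set l := 1 + A / ε with hl
  have hl1 : 1 ≤ l := by have : 0 ≤ A / ε := by positivity
                         linarith
  have hAl : A ≤ ε * l ^ 3 := by
    have h1 : l ≤ l ^ 3 := le_self_pow₀ hl1 (by norm_num)
    have h2 : ε * (A / ε) = A := by field_simp
    nlinarith [mul_le_mul_of_nonneg_left h1 hε.le]
  refine ⟨A * l, by positivity, fun q s e hs he hq => ?_⟩
  have h0 : q * s ≤ A * e ^ 3 * s := by gcongr
  refine h0.trans ?_
  rcases le_total s (l * e) with h | h
  · have h1 : A * e ^ 3 * s ≤ A * e ^ 3 * (l * e) := by gcongr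
    have h2 : 0 ≤ ε * s ^ 4 := by positivity
    nlinarith
  · have h1 : (l * e) ^ 3 ≤ s ^ 3 := by gcongr
    have h2 : A * e ^ 3 * s ≤ ε * l ^ 3 * e ^ 3 * s := by gcongr
    have h3 : ε * s * (l * e) ^ 3 ≤ ε * s * s ^ 3 := by gcongr
    have h4 : 0 ≤ A * l * e ^ 4 := by positivity
    nlinarith

/-- Young's inequality with exponents `3/2` and `3`, by splitting at `s * k = l * w`. It is applied
with `w = √τ`, `s = √h`, `k = √(μ + β)` and `e = 1/n`; the roots avoid fractional powers. -/
theorem exists_mul_le_cubic {A ε : ℝ} (hA : 0 ≤ A) (hε : 0 < ε) :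
    ∃ K, 0 ≤ K ∧ ∀ w s k e : ℝ, 0 ≤ w → 0 ≤ s → 0 < k → 0 ≤ e → w ^ 3 ≤ A * k ^ 2 * e →
      w ^ 2 * s / k ≤ ε * (k * s ^ 3) + K * e := by
  set l := 1 + 1 / ε with hl
  have hi : 0 < 1 / ε := by positivity
  have hl1 : 1 ≤ l := by linarith
  have hl2 : 1 ≤ ε * l ^ 2 := by
    have h1 : l ≤ l ^ 2 := le_self_pow₀ hl1 (by norm_num)
    have h2 : ε * (1 / ε) = 1 := by field_simp
    nlinarith [mul_le_mul_of_nonneg_left h1 hε.le]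
  refine ⟨l * A, by positivity, fun w s k e hw hs hk he hwe => ?_⟩
  rw [div_le_iff₀ hk]
  rcases le_total (s * k) (l * w) with h | h
  · have h1 : w ^ 2 * (s * k) ≤ w ^ 2 * (l * w) := by gcongr
    have h2 : l * w ^ 3 ≤ l * (A * k ^ 2 * e) := by gcongr
    have h3 : 0 ≤ ε * (k * s ^ 3) * k := by positivity
    have h4 : w ^ 2 * s * k ≤ (l * A * e) * k * k := by nlinarith
    have h5 : w ^ 2 * s ≤ (l * A * e) * k := le_of_mul_le_mul_right h4 hk
    nlinarith
  · have h1 : (l * w) ^ 2 ≤ (s * k) ^ 2 := by gcongr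
    have h2 : 1 * (w ^ 2 * s) ≤ ε * l ^ 2 * (w ^ 2 * s) := by gcongr
    have h3 : ε * s * (l * w) ^ 2 ≤ ε * s * (s * k) ^ 2 := by gcongr
    have h4 : 0 ≤ l * A * e * k := by positivity
    nlinarith

/-- Rates from the recursive estimates, a Young-type absorption of the errors and a growth
condition on the dual progress. -/
theorem exists_rate_of_estimates {μ a r c c' B C C' : ℝ} (har : a + r = 1) (ha : 0 < a)
    (hr : 0 < r) (hc : 0 < c) (hc' : 0 < c') (hB : 0 ≤ B) (hC : 0 ≤ C) (hC' : 0 ≤ C')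
    {t₀ : ℕ} {τ β : ℕ → ℝ} (hτ : ∀ t ≥ t₀, c * ((t : ℝ) + 1) ^ (-a) ≤ τ t)
    (hβ0 : ∀ t, 0 ≤ β t) (hβ : ∀ t : ℕ, β t ≤ B * ((t : ℝ) + 1) ^ (-r)) :
    ∃ K, ∀ G h π Φ : ℕ → ℝ, Estimates μ τ β C G h π Φ →
      (∀ t : ℕ, C * (τ t * Real.sqrt (h t / (μ + β t)) + τ t ^ 2 / (μ + β t))
        ≤ π t / 2 + C' / ((t : ℝ) + 1)) →
      (∀ (t : ℕ) (m : ℝ), 1 ≤ m → m ^ 2 * ((t : ℝ) + 1) ^ (-r) ≤ h t →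
        c' * m ^ 3 / ((t : ℝ) + 1) ≤ π t) →
      ∀ T : ℕ, (1 / ((T : ℝ) + 1)) * ∑ t ∈ Finset.range (T + 1), G t
          ≤ K * ((T : ℝ) + 1) ^ (-r) ∧
        h T + C * β T ≤ K * ((T : ℝ) + 1) ^ (-r) := by
  have hβB : ∀ t, β t ≤ B := fun t => (hβ t).trans (mul_le_of_le_one_right hB
    (Real.rpow_le_one_of_one_le_of_nonpos (by linarith [t.cast_nonneg (α := ℝ)]) (by linarith)))
  obtain ⟨K₁, hK₁⟩ := average_le_of_descent (B := 2 * C + 2 * (C * B)) (C := 2 * C') (g := C)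
    ha (by linarith) hc (by positivity) hC (by positivity) hτ
  obtain ⟨K₂, hK₂⟩ := le_rpow_of_recursion (r := r) (c := c') (B := C * B)
    (C := C' + C + C * B) hr.le (by linarith) hc' (by positivity) (by positivity)
  refine ⟨max K₁ K₂, fun G h π Φ hE hY hgrow T => ⟨?_, ?_⟩⟩
  -- In this potential the two errors contribute at most `2 * (π t / 2)`, which the dual progress `π
  -- t` cancels.
  · have := hK₁ G (fun t => Φ t + h t + 2 * (C * β t)) hE.G_nonneg hE.G_le (fun t => by
      have h1 := abs_le.1 (hE.abs_Φ_le t)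
      have h2 := hE.h_nonneg t
      have h3 := hE.h_le t
      have h4 : C * β t ≤ C * B := mul_le_mul_of_nonneg_left (hβB t) hC
      have h5 : 0 ≤ C * β t := mul_nonneg hC (hβ0 t)
      rw [abs_le]
      constructor <;> linarith) (fun t => by
      have h1 := hE.dual t
      have h2 := hE.primal t
      have h3 := hY t
      rw [mul_div_assoc]
      linarith) T
    rw [show a - 1 = -r by linarith] at this
    exact this.trans (by gcongr; exact le_max_left _ _)
  · have := hK₂ h (fun t => C * β t) π hE.π_nonneg (fun t => by
      rw [mul_assoc]; exact mul_le_mul_of_nonneg_left (hβ t) hC) (by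
      have h3 := hE.h_le 0
      have h4 : C * β 0 ≤ C * B := mul_le_mul_of_nonneg_left (hβB 0) hC
      linarith) (fun t => by
      have h1 := hE.dual t
      have h3 := hY t
      have h4 : C' / ((t : ℝ) + 1) ≤ (C' + C + C * B) / ((t : ℝ) + 1) := by
        gcongr
        have : 0 ≤ C * B := by positivity
        linarith
      linarith) hgrow T
    exact this.trans (by gcongr; exact le_max_right _ _)

/-! ### From asymptotic schedules to explicit bounds. -/

theorem rpow_neg_isTheta_succ {a : ℝ} (ha0 : 0 ≤ a) (ha1 : a ≤ 1) :
    (fun t : ℕ => (t : ℝ) ^ (-a)) =Θ[atTop] (fun t : ℕ => ((t : ℝ) + 1) ^ (-a)) := by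
  constructor
  · refine IsBigO.of_bound 2 ?_
    filter_upwards [eventually_ge_atTop 1] with t ht
    rw [Real.norm_of_nonneg (by positivity), Real.norm_of_nonneg (by positivity)]
    exact rpow_neg_le_two_mul_succ ha0 ha1 (by exact_mod_cast ht)
  · refine IsBigO.of_bound 1 ?_
    filter_upwards [eventually_ge_atTop 1] with t ht
    rw [Real.norm_of_nonneg (by positivity), Real.norm_of_nonneg (by positivity), one_mul]
    have : (0 : ℝ) < t := by exact_mod_cast ht
    exact Real.rpow_le_rpow_of_nonpos this (by linarith) (by linarith)

theorem exists_le_of_isTheta {a : ℝ} (ha0 : 0 ≤ a) (ha1 : a ≤ 1) {f : ℕ → ℝ}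
    (hf : f =Θ[atTop] (fun t : ℕ => (t : ℝ) ^ (-a))) :
    ∃ A, 0 ≤ A ∧ ∀ t : ℕ, f t ≤ A * ((t : ℝ) + 1) ^ (-a) := by
  obtain ⟨A, hA, h⟩ := bound_of_isBigO_nat_atTop (hf.trans (rpow_neg_isTheta_succ ha0 ha1)).1
  refine ⟨A, hA.le, fun t => ?_⟩
  have hpos : (0 : ℝ) < ((t : ℝ) + 1) ^ (-a) := by positivity
  have := h hpos.ne'
  rw [Real.norm_of_nonneg hpos.le] at this
  exact (le_abs_self _).trans this

theorem IsStepsize.exists_ge {a : ℝ} (ha0 : 0 ≤ a) (ha1 : a ≤ 1) {τ : ℕ → ℝ}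
    (hτ : IsStepsize a τ) :
    ∃ c, 0 < c ∧ ∃ t₀ : ℕ, ∀ t ≥ t₀, c * ((t : ℝ) + 1) ^ (-a) ≤ τ t := by
  obtain ⟨A, hA, h⟩ := (hτ.theta.trans (rpow_neg_isTheta_succ ha0 ha1)).2.exists_pos
  obtain ⟨t₀, ht₀⟩ := eventually_atTop.1 h.bound
  refine ⟨A⁻¹, by positivity, t₀, fun t ht => ?_⟩
  have := ht₀ t ht
  rw [Real.norm_of_nonneg (by positivity), Real.norm_of_nonneg (hτ.mem_Icc t).1] at this
  rwa [inv_mul_le_iff₀ hA]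

/-- Positivity of every `β t` makes the bound hold from `t = 0` on; for stepsizes it holds only
eventually. -/
theorem IsSmoothing.exists_ge {b : ℝ} (hb0 : 0 ≤ b) (hb1 : b ≤ 1) {β : ℕ → ℝ}
    (hβ : IsSmoothing b β) :
    ∃ c, 0 < c ∧ ∀ t : ℕ, c * ((t : ℝ) + 1) ^ (-b) ≤ β t := by
  obtain ⟨A, hA, h⟩ :=
    bound_of_isBigO_nat_atTop (hβ.theta.trans (rpow_neg_isTheta_succ hb0 hb1)).2
  refine ⟨A⁻¹, by positivity, fun t => ?_⟩
  have := h (hβ.pos t).ne'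
  rw [Real.norm_of_nonneg (by positivity), Real.norm_of_nonneg (hβ.pos t).le] at this
  rwa [inv_mul_le_iff₀ hA]

/-! ### The two convergence rates and their four instances. -/

/-- The rate for a general compact convex dual set. -/
theorem Problem.hasRate (hP : Problem X Y L μ Lxx Lyx Lyy) {a b r c B : ℝ} {τ β : ℕ → ℝ}
    (har : a + r = 1) (ha : 0 < a) (hr : 0 < r) (hr2 : 2 * r ≤ 1) (hab : 3 / 2 ≤ 2 * a - b)
    (hτ : IsStepsize a τ) (hβ0 : ∀ t, 0 ≤ β t) (hanti : Antitone β) (hB : 0 ≤ B)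
    (hβ : ∀ t : ℕ, β t ≤ B * ((t : ℝ) + 1) ^ (-r)) (hc : 0 < c)
    (hσ : ∀ t : ℕ, c * ((t : ℝ) + 1) ^ (-b) ≤ μ + β t) :
    HasRate X Y L Lyy τ β r := by
  have hσ0 : ∀ t, 0 < μ + β t := fun t => lt_of_lt_of_le (by positivity) (hσ t)
  obtain ⟨C, hC, hest⟩ := hP.exists_estimates hβ0 hanti hσ0 hτ.mem_Icc
  obtain ⟨c₁, hc₁, t₀, hlow⟩ := hτ.exists_ge ha.le (by linarith)
  obtain ⟨A, hA, hup⟩ := exists_le_of_isTheta ha.le (by linarith) hτ.theta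
  -- With `h t ^ 2 ≤ C * π t` and the factor `C` in front of the error, this `ε` yields exactly `π t
  -- / 2`.
  obtain ⟨K, hK, hyoung⟩ := exists_mul_le_quartic (A := Real.sqrt (A ^ 2 / c))
    (ε := 1 / (2 * C ^ 2)) (Real.sqrt_nonneg _) (by positivity)
  obtain ⟨R, hR⟩ := exists_rate_of_estimates (μ := μ) (c' := 1 / C)
    (C' := C * (K + A ^ 2 / c)) har ha hr hc₁ (by positivity) hB hC.le (by positivity) hlow hβ0 hβ
  refine ⟨R, fun x y hrun T => ?_⟩
  obtain ⟨h, π, Φ, hE, hgap, hprog, -⟩ := hest x y hrun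
  have key := hR _ h π Φ hE ?_ ?_ T
  · exact ⟨key.1, (hgap T).trans key.2⟩
  · intro t
    have hτ0 := (hτ.mem_Icc t).1
    have hn1 : (1 : ℝ) ≤ (t : ℝ) + 1 := by linarith [t.cast_nonneg (α := ℝ)]
    have hup' := hup t
    have hσ' := hσ t
    have hσt := hσ0 t
    set n := (t : ℝ) + 1 with hn
    have hn0 : 0 < n := by linarith
    set e := n ^ (-(1 / 4 : ℝ)) with he
    have he0 : 0 < e := by positivity
    have he1 : e ≤ 1 := Real.rpow_le_one_of_one_le_of_nonpos hn1 (by norm_num)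
    have he4 : e ^ 4 = 1 / n := by
      rw [he, ← Real.rpow_natCast, ← Real.rpow_mul hn0.le, one_div n, ← Real.rpow_neg_one]
      congr 1
      norm_num
    have he6 : e ^ 6 = n ^ (-(3 / 2 : ℝ)) := by
      rw [he, ← Real.rpow_natCast, ← Real.rpow_mul hn0.le]
      norm_num
    have h1 : τ t ^ 2 / (μ + β t) ≤ A ^ 2 / c * e ^ 6 := by
      rw [div_le_iff₀ hσt]
      have h2 : n ^ (-a) * n ^ (-a) ≤ e ^ 6 * n ^ (-b) := by
        rw [he6, ← Real.rpow_add hn0, ← Real.rpow_add hn0]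
        exact Real.rpow_le_rpow_of_exponent_le hn1 (by linarith)
      calc τ t ^ 2 ≤ (A * n ^ (-a)) ^ 2 := by gcongr
        _ = A ^ 2 * (n ^ (-a) * n ^ (-a)) := by ring
        _ ≤ A ^ 2 * (e ^ 6 * n ^ (-b)) := by gcongr
        _ = A ^ 2 / c * e ^ 6 * (c * n ^ (-b)) := by field_simp
        _ ≤ A ^ 2 / c * e ^ 6 * (μ + β t) := by gcongr
    have h2 : τ t / Real.sqrt (μ + β t) ≤ Real.sqrt (A ^ 2 / c) * e ^ 3 := by
      rw [← Real.sqrt_sq (by positivity : 0 ≤ e ^ 3), ← Real.sqrt_mul (by positivity)]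
      apply Real.le_sqrt_of_sq_le
      rw [div_pow, Real.sq_sqrt hσt.le]
      calc _ ≤ _ := h1
        _ = _ := by ring
    have h3 := hyoung _ (Real.sqrt (h t)) e (Real.sqrt_nonneg _) he0.le h2
    have h4 : Real.sqrt (h t) ^ 4 = h t ^ 2 := by
      rw [show 4 = 2 * 2 from rfl, pow_mul, Real.sq_sqrt (hE.h_nonneg t)]
    have h5 : τ t * Real.sqrt (h t / (μ + β t))
        = τ t / Real.sqrt (μ + β t) * Real.sqrt (h t) := by
      rw [Real.sqrt_div (hE.h_nonneg t)]; ring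
    have h6 : A ^ 2 / c * e ^ 6 ≤ A ^ 2 / c * e ^ 4 := by
      gcongr ?_ * ?_
      exact pow_le_pow_of_le_one he0.le he1 (by norm_num)
    have h7 : 1 / (2 * C ^ 2) * h t ^ 2 ≤ 1 / (2 * C ^ 2) * (C * π t) := by
      gcongr
      exact hprog t
    rw [h4, ← h5] at h3
    calc C * (τ t * Real.sqrt (h t / (μ + β t)) + τ t ^ 2 / (μ + β t))
        ≤ C * (1 / (2 * C ^ 2) * (C * π t) + K * e ^ 4 + A ^ 2 / c * e ^ 4) := by
          gcongr
          · exact h3.trans (by gcongr)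
          · exact h1.trans h6
      _ = π t / 2 + C * (K + A ^ 2 / c) / n := by
          rw [he4]; field_simp; ring
  · intro t m hm hmh
    have hn1 : (1 : ℝ) ≤ (t : ℝ) + 1 := by linarith [t.cast_nonneg (α := ℝ)]
    set n := (t : ℝ) + 1 with hn
    have hn0 : 0 < n := by linarith
    have h1 : 1 / n ≤ (n ^ (-r)) ^ 2 := by
      rw [← Real.rpow_natCast, ← Real.rpow_mul hn0.le, one_div, ← Real.rpow_neg_one]
      exact Real.rpow_le_rpow_of_exponent_le hn1 (by push_cast; linarith)
    -- One power of `m` is given up to match the growth condition shared with the strongly convex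
    -- case.
    have h2 : m ^ 3 ≤ m ^ 4 := pow_le_pow_right₀ hm (by norm_num)
    have h3 : m ^ 3 * (1 / n) ≤ C * π t := by
      calc m ^ 3 * (1 / n) ≤ m ^ 4 * (n ^ (-r)) ^ 2 := by gcongr
        _ = (m ^ 2 * n ^ (-r)) ^ 2 := by ring
        _ ≤ h t ^ 2 := by gcongr
        _ ≤ C * π t := hprog t
    calc 1 / C * m ^ 3 / n = 1 / C * (m ^ 3 * (1 / n)) := by ring
      _ ≤ 1 / C * (C * π t) := by gcongr
      _ = π t := by field_simp

/-- The rate for a strongly convex dual set. -/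
theorem Problem.hasRate_of_stronglyConvexSet (hP : Problem X Y L μ Lxx Lyx Lyy)
    {α : ℝ} (hα : 0 < α) (hY : StronglyConvexSet Y α) {a b r c B : ℝ} {τ β : ℕ → ℝ}
    (har : a + r = 1) (ha : 0 < a) (hr : 0 < r)
    (hab : 1 ≤ 3 / 2 * a - b) (hτ : IsStepsize a τ) (hβ0 : ∀ t, 0 ≤ β t) (hanti : Antitone β)
    (hB : 0 ≤ B) (hβ : ∀ t : ℕ, β t ≤ B * ((t : ℝ) + 1) ^ (-r)) (hc : 0 < c)
    (hσ : ∀ t : ℕ, c * ((t : ℝ) + 1) ^ (-b) ≤ μ + β t) :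
    HasRate X Y L Lyy τ β r := by
  have hσ0 : ∀ t, 0 < μ + β t := fun t => lt_of_lt_of_le (by positivity) (hσ t)
  obtain ⟨C, hC, hest⟩ := hP.exists_estimates hβ0 hanti hσ0 hτ.mem_Icc
  obtain ⟨c₁, hc₁, t₀, hlow⟩ := hτ.exists_ge ha.le (by linarith)
  obtain ⟨A, hA, hup⟩ := exists_le_of_isTheta ha.le (by linarith) hτ.theta
  set D := C + C / α with hD
  have hD0 : 0 < D := by positivity
  set A' := Real.sqrt A ^ 3 / c with hA'
  have hA'0 : 0 ≤ A' := by positivity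
  -- The progress constant is now `D`, so this `ε` again leaves `π t / 2`.
  obtain ⟨K, hK, hyoung⟩ := exists_mul_le_cubic (A := A') (ε := 1 / (2 * C * D)) hA'0
    (by positivity)
  obtain ⟨R, hR⟩ := exists_rate_of_estimates (μ := μ) (c' := Real.sqrt c / D)
    (C' := C * (K + A')) har ha hr hc₁ (by positivity) hB hC.le (by positivity) hlow hβ0 hβ
  refine ⟨R, fun x y hrun T => ?_⟩
  obtain ⟨h, π, Φ, hE, hgap, -, hsc⟩ := hest x y hrun
  have hprog := hsc α hα hY
  have key := hR _ h π Φ hE ?_ ?_ T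
  · exact ⟨key.1, (hgap T).trans key.2⟩
  · intro t
    have hτ0 := (hτ.mem_Icc t).1
    have hτ1 := (hτ.mem_Icc t).2
    have hn1 : (1 : ℝ) ≤ (t : ℝ) + 1 := by linarith [t.cast_nonneg (α := ℝ)]
    have hup' := hup t
    have hσ' := hσ t
    have hσt := hσ0 t
    have hh0 := hE.h_nonneg t
    set n := (t : ℝ) + 1 with hn
    have hn0 : 0 < n := by linarith
    set w := Real.sqrt (τ t) with hw
    set k := Real.sqrt (μ + β t) with hk
    have hw0 : 0 ≤ w := Real.sqrt_nonneg _
    have hk0 : 0 < k := Real.sqrt_pos.2 hσt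
    have hk2 : k ^ 2 = μ + β t := Real.sq_sqrt hσt.le
    have hw2 : w ^ 2 = τ t := Real.sq_sqrt hτ0
    have hw1 : w ≤ 1 := Real.sqrt_le_one.2 hτ1
    have h1 : w ^ 3 ≤ A' * k ^ 2 * (1 / n) := by
      have h2 : Real.sqrt (n ^ (-a)) ^ 3 ≤ n ^ (-b) * (1 / n) := by
        rw [Real.sqrt_eq_rpow, ← Real.rpow_mul hn0.le, ← Real.rpow_natCast,
          ← Real.rpow_mul hn0.le, one_div n, ← Real.rpow_neg_one, ← Real.rpow_add hn0]
        exact Real.rpow_le_rpow_of_exponent_le hn1 (by push_cast; linarith)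
      calc w ^ 3 ≤ Real.sqrt (A * n ^ (-a)) ^ 3 := by gcongr; exact Real.sqrt_le_sqrt hup'
        _ = Real.sqrt A ^ 3 * Real.sqrt (n ^ (-a)) ^ 3 := by rw [Real.sqrt_mul hA, mul_pow]
        _ ≤ Real.sqrt A ^ 3 * (n ^ (-b) * (1 / n)) := by gcongr
        _ = A' * (c * n ^ (-b)) * (1 / n) := by rw [hA']; field_simp
        _ ≤ A' * k ^ 2 * (1 / n) := by rw [hk2]; gcongr
    have h2 : τ t ^ 2 / (μ + β t) ≤ A' * (1 / n) := by
      rw [div_le_iff₀ hσt, ← hk2, ← hw2, ← pow_mul]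
      have : w ^ (2 * 2) ≤ w ^ 3 := pow_le_pow_of_le_one hw0 hw1 (by norm_num)
      exact this.trans (h1.trans (le_of_eq (by ring)))
    have h3 := hyoung w (Real.sqrt (h t)) k (1 / n) hw0 (Real.sqrt_nonneg _) hk0
      (by positivity) h1
    have h4 : Real.sqrt (h t) ^ 3 = Real.sqrt (h t) * h t := by
      rw [pow_succ, Real.sq_sqrt hh0, mul_comm]
    have h5 : τ t * Real.sqrt (h t / (μ + β t)) = w ^ 2 * Real.sqrt (h t) / k := by
      rw [Real.sqrt_div hh0, hw2]; ring
    have h7 : 1 / (2 * C * D) * (k * Real.sqrt (h t) * h t)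
        ≤ 1 / (2 * C * D) * (D * π t) :=
      mul_le_mul_of_nonneg_left (hprog t) (by positivity)
    rw [h4, ← h5, ← mul_assoc k] at h3
    calc C * (τ t * Real.sqrt (h t / (μ + β t)) + τ t ^ 2 / (μ + β t))
        ≤ C * (1 / (2 * C * D) * (D * π t) + K * (1 / n) + A' * (1 / n)) := by
          gcongr
          exact h3.trans (by gcongr)
      _ = π t / 2 + C * (K + A') / n := by field_simp; ring
  · intro t m hm hmh
    have hn1 : (1 : ℝ) ≤ (t : ℝ) + 1 := by linarith [t.cast_nonneg (α := ℝ)]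
    have hσ' := hσ t
    have hpt := hprog t
    set n := (t : ℝ) + 1 with hn
    have hn0 : 0 < n := by linarith
    have h1 : 1 / n ≤ Real.sqrt (n ^ (-b)) * Real.sqrt (n ^ (-r)) * n ^ (-r) := by
      rw [Real.sqrt_eq_rpow, Real.sqrt_eq_rpow, ← Real.rpow_mul hn0.le, ← Real.rpow_mul hn0.le,
        ← Real.rpow_add hn0, ← Real.rpow_add hn0, one_div, ← Real.rpow_neg_one]
      exact Real.rpow_le_rpow_of_exponent_le hn1 (by linarith)
    have hm0 : 0 ≤ m := by linarith
    have h3 : Real.sqrt c * m ^ 3 * (1 / n) ≤ D * π t := by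
      calc Real.sqrt c * m ^ 3 * (1 / n)
          ≤ Real.sqrt c * m ^ 3
            * (Real.sqrt (n ^ (-b)) * Real.sqrt (n ^ (-r)) * n ^ (-r)) := by gcongr
        _ = Real.sqrt (c * n ^ (-b)) * Real.sqrt (m ^ 2 * n ^ (-r)) * (m ^ 2 * n ^ (-r)) := by
          rw [Real.sqrt_mul hc.le, Real.sqrt_mul (by positivity), Real.sqrt_sq hm0]; ring
        _ ≤ Real.sqrt (μ + β t) * Real.sqrt (h t) * h t := by gcongr
        _ ≤ D * π t := hpt
    calc Real.sqrt c / D * m ^ 3 / n = 1 / D * (Real.sqrt c * m ^ 3 * (1 / n)) := by ring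
      _ ≤ 1 / D * (D * π t) := by gcongr
      _ = π t := by field_simp

end MinimaxLMO

theorem theorem1 {nx ny : ℕ} (X : Set (MinimaxLMO.Vec nx)) (Y : Set (MinimaxLMO.Vec ny))
    (L : MinimaxLMO.Vec nx → MinimaxLMO.Vec ny → ℝ) (μ Lxx Lyx Lyy : ℝ)
    (hP : MinimaxLMO.Problem X Y L μ Lxx Lyx Lyy) :
    -- nonconvex-concave
    (∀ τ β : ℕ → ℝ, MinimaxLMO.IsStepsize (5 / 6) τ → MinimaxLMO.IsSmoothing (1 / 6) β →
      MinimaxLMO.HasRate X Y L Lyy τ β (1 / 6)) ∧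
    -- nonconvex-strongly concave
    (0 < μ → ∀ τ : ℕ → ℝ, MinimaxLMO.IsStepsize (3 / 4) τ →
      MinimaxLMO.HasRate X Y L Lyy τ (fun _ => 0) (1 / 4)) ∧
    -- nonconvex-concave, strongly convex `Y`
    (∀ α : ℝ, 0 < α → MinimaxLMO.StronglyConvexSet Y α →
      ∀ τ β : ℕ → ℝ, MinimaxLMO.IsStepsize (4 / 5) τ → MinimaxLMO.IsSmoothing (1 / 5) β →
        MinimaxLMO.HasRate X Y L Lyy τ β (1 / 5)) ∧
    -- nonconvex-strongly concave, strongly convex `Y`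
    (0 < μ → ∀ α : ℝ, 0 < α → MinimaxLMO.StronglyConvexSet Y α →
      ∀ τ : ℕ → ℝ, MinimaxLMO.IsStepsize (2 / 3) τ →
        MinimaxLMO.HasRate X Y L Lyy τ (fun _ => 0) (1 / 3)) := by
  refine ⟨fun τ β hτ hβ => ?_, fun hμ τ hτ => ?_, fun α hα hY τ β hτ hβ => ?_,
    fun hμ α hα hY τ hτ => ?_⟩
  · obtain ⟨c, hc, hlow⟩ := hβ.exists_ge (by norm_num) (by norm_num)
    obtain ⟨B, hB, hup⟩ :=
      MinimaxLMO.exists_le_of_isTheta (by norm_num) (by norm_num) hβ.theta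
    exact hP.hasRate (by norm_num) (by norm_num) (by norm_num) (by norm_num) (by norm_num) hτ
      (fun t => (hβ.pos t).le) hβ.antitone hB hup hc
      (fun t => (hlow t).trans (le_add_of_nonneg_left hP.mu_nonneg))
  -- Without smoothing, `μ` itself is the strong concavity modulus, hence exponent `0` and constant
  -- `μ`.
  · exact hP.hasRate (b := 0) (B := 0) (c := μ) (by norm_num) (by norm_num) (by norm_num)
      (by norm_num) (by norm_num) hτ (fun _ => le_rfl) antitone_const le_rfl
      (fun t => by simp) hμ (fun t => by simp)
  · obtain ⟨c, hc, hlow⟩ := hβ.exists_ge (by norm_num) (by norm_num)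
    obtain ⟨B, hB, hup⟩ :=
      MinimaxLMO.exists_le_of_isTheta (by norm_num) (by norm_num) hβ.theta
    exact hP.hasRate_of_stronglyConvexSet hα hY (by norm_num) (by norm_num) (by norm_num)
      (by norm_num) hτ (fun t => (hβ.pos t).le) hβ.antitone hB hup hc
      (fun t => (hlow t).trans (le_add_of_nonneg_left hP.mu_nonneg))
  · exact hP.hasRate_of_stronglyConvexSet hα hY (b := 0) (B := 0) (c := μ) (by norm_num)
      (by norm_num) (by norm_num) (by norm_num) hτ (fun _ => le_rfl)
      antitone_const le_rfl (fun t => by simp) hμ (fun t => by simp)
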